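/- Let $p\ge 1$ be an integer and let $\mathcal A_p^{\pm}=z\pm\frac{1}{pz^p}\bigl(z\partial_z-\frac{p-1}{2}\bigr)$, acting on the field $\mathbb C((z^{-1}))$ of formal Laurent series in $1/z$. Let $\mathrm{Gr}$ be (the big cell of) Sato's Grassmannian: the set of linear subspaces $\mathcal W\subset\mathbb C((z^{-1}))$ that are spanned by some elements $\varphi_n=z^n+\sum_{i\le n-1}a_{ni}z^i$, $n=0,1,2,\dots$ A solution of the KP hierarchy is given by a formal pseudo-differential operator $S=1+\sum_{j\ge1}w_jD^{-j}$, $D=\partial_x$, $w_j\in\mathbb C[[x,t_1,t_2,\dots]]$, with $\partial_{t_i}S=-(SD^iS^{-1})_-S$ for all $i\ge1$, where $(\cdot)_-$ is the part of negative order in $D$. Its wave function and adjoint wave function are $$\Psi^+(x,\mathbf t;z)=S\,e^{xz+\sum t_iz^i},\qquad \Psi^-(x,\mathbf t;z)=(S^{-1})^*e^{-xz-\sum t_iz^i},$$ with $^*$ the formal adjoint, regarded as formal power series in $x,t_1,t_2,\dots$ with coefficients in $\mathbb C((z^{-1}))$, and its planes are $\mathcal W^\pm=\mathrm{span}_{i\ge0}\{D^i\Psi^\pm(x,0;z)|_{x=0}\}$;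 $\mathcal W^-$ is called the adjoint of $\mathcal W^+$. Then: 1. There is exactly one $\mathcal W_p^+\in\mathrm{Gr}$ with $z^p\mathcal W_p^+\subset\mathcal W_p^+$ and $\mathcal A_p^+\mathcal W_p^+\subset\mathcal W_p^+$, and exactly one $\mathcal W_p^-\in\mathrm{Gr}$ with $z^p\mathcal W_p^-\subset\mathcal W_p^-$ and $\mathcal A_p^-\mathcal W_p^-\subset\mathcal W_p^-$. 2. For each sign there is exactly one series $\varphi_p^\pm=1+\sum_{i\ge1}a_i^\pm z^{-i}$ with $(\mathcal A_p^\pm)^p\varphi_p^\pm=z^p\varphi_p^\pm$, and $\mathcal W_p^\pm=\mathrm{span}_{i\ge0}\{(\mathcal A_p^\pm)^i\varphi_p^\pm\}$. 3. There is exactly one solution of the KP hierarchy with $\mathcal W^+=\mathcal W_p^+$, and for it $\mathcal W^-=\mathcal W_p^-$, i.e. $\mathcal W_p^-$ is the adjoint of $\mathcal W_p^+$. 4. If $p\ge2$, the wave functions $\Psi_p^\pm$ of this solution satisfy $$\Psi_p^\pm(0,0;z)=\varphi_p^\pm(z),\qquad \mathcal A_p^\pm\Psi_p^\pm(x,0;z)=\pm\frac{\partial}{\partial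 x}\Psi_p^\pm(x,0;z),$$ and $\Psi_p^\pm(x,0;z)$ is the only formal power series in $x$ with coefficients in $\mathbb C((z^{-1}))$ that satisfies these two conditions. -/

import Mathlib

noncomputable section

namespace KP

theorem bddBelow_of_lt {R : Type*} [Zero R] {f : ℤ → R} (N : ℤ) (h : ∀ n, n < N → f n = 0) :
    BddBelow (Function.support f) :=
  ⟨N, fun n hn => not_lt.mp fun hlt => hn (h n hlt)⟩

/-! ### Formal Laurent series in `1/z` and the operators `A_p^±`

The sign `±` is a unit `ε : ℤˣ`, i.e. `ε = 1` or `ε = -1`. -/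

/-- The field `ℂ((1/z))`. The uniformizer is `1/z`: for `f : Lau`, `f.coeff n` is the
coefficient of `z ^ (-n)`. -/
abbrev Lau : Type := LaurentSeries ℂ

/-- The monomial `z ^ n`, `n : ℤ`. -/
def zpow (n : ℤ) : Lau := HahnSeries.single (-n) 1

/-- The Euler operator `z ∂_z`, which multiplies `z ^ (-n)` by `-n`. -/
def euler : Module.End ℂ Lau where
  toFun f := HahnSeries.ofSuppBddBelow (fun n : ℤ => -(n : ℂ) * f.coeff n)
    (bddBelow_of_lt f.order fun n hn => by
      simp [HahnSeries.coeff_eq_zero_of_lt_order hn])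
  map_add' f g := by
    ext n
    simp [mul_add]
  map_smul' c f := by
    ext n
    simp [mul_left_comm]

/-- Multiplication by `z ^ n`. -/
def mulZ (n : ℤ) : Module.End ℂ Lau where
  toFun f := zpow n * f
  map_add' f g := mul_add _ f g
  map_smul' c f := by
    simp only [RingHom.id_apply]
    rw [← HahnSeries.single_zero_mul_eq_smul, ← HahnSeries.single_zero_mul_eq_smul,
      mul_left_comm]

/-- `A_p^ε = z + ε (1 / (p z ^ p)) (z ∂_z - (p - 1) / 2)`. -/
def opA (p : ℕ) (ε : ℤˣ) : Module.End ℂ Lau :=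
  mulZ 1 + (((ε : ℤ) : ℂ) / (p : ℂ)) • (mulZ (-(p : ℤ)) * (euler - (((p : ℂ) - 1) / 2) • 1))

/-- `f = z ^ n + (lower powers of z)`. -/
def IsMonic (n : ℕ) (f : Lau) : Prop :=
  f.coeff (-(n : ℤ)) = 1 ∧ ∀ k : ℤ, k < -(n : ℤ) → f.coeff k = 0

/-- (The big cell of) Sato's Grassmannian: the subspaces of `ℂ((1/z))` that are spanned by some
`φ_n = z ^ n + (lower powers of z)`, `n = 0, 1, 2, …`. -/
def Gr : Set (Submodule ℂ Lau) :=
  {V | ∃ b : ℕ → Lau, (∀ n, IsMonic n (b n)) ∧ V = Submodule.span ℂ (Set.range b)}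

/-- `T V ⊆ V`. -/
def Stable (T : Module.End ℂ Lau) (V : Submodule ℂ Lau) : Prop := V.map T ≤ V

/-! ### Formal pseudo-differential operators in `x`

The coefficients are formal power series in `x, t_1, t_2, …`. -/

/-- `ℂ[[x, t_1, t_2, …]]`: the variable with index `0` is `x`, the one with index `i ≥ 1` is the
time `t_i`. -/
abbrev Fun : Type := MvPowerSeries ℕ ℂ

/-- The partial derivative in the variable with index `i`. -/
def del (i : ℕ) : Module.End ℂ Fun := (MvPowerSeries.pderiv ℂ i).toLinearMap

/-- Formal pseudo-differential operators `∑_{n ≥ N} a_n D ^ (-n)`, with `D = ∂_x` and the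
coefficients on the left; `a.coeff n` is the coefficient of `D ^ (-n)`. Only the additive
structure of this type is used; the product of operators is `comp`. -/
abbrev PsDO : Type := LaurentSeries Fun

/-- The operator `D ^ n`, `n : ℤ`. -/
def Dpow (n : ℤ) : PsDO := HahnSeries.single (-n) 1

/-- Composition of pseudo-differential operators, by the Leibniz rule
`a D ^ (-i) ∘ b D ^ (-j) = ∑_{k ≥ 0} binom(-i, k) a b^{(k)} D ^ (-i - j - k)`. All but finitely
many terms of each sum below vanish. -/
def comp (a b : PsDO) : PsDO :=
  HahnSeries.ofSuppBddBelow (fun n : ℤ => ∑ᶠ q : ℤ × ℕ,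
      Ring.choose (-q.1) q.2 •
        (a.coeff q.1 * ((del 0) ^ q.2) (b.coeff (n - q.1 - (q.2 : ℤ)))))
    (bddBelow_of_lt (a.order + b.order) fun n hn => by
      refine (finsum_congr fun q => ?_).trans finsum_zero
      by_cases h : q.1 < a.order
      · simp [HahnSeries.coeff_eq_zero_of_lt_order h]
      · have h' : n - q.1 - (q.2 : ℤ) < b.order := by omega
        simp [HahnSeries.coeff_eq_zero_of_lt_order h'])

/-- The formal adjoint: `(a D ^ (-i))^* = (-D) ^ (-i) ∘ a
= ∑_{k ≥ 0} (-1) ^ i binom(-i, k) a^{(k)} D ^ (-i - k)`. All but finitely many terms of each sum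
below vanish. -/
def adj (a : PsDO) : PsDO :=
  HahnSeries.ofSuppBddBelow (fun n : ℤ => ∑ᶠ k : ℕ,
      (((n - (k : ℤ)).negOnePow : ℤ) * Ring.choose (-(n - (k : ℤ))) k) •
        ((del 0) ^ k) (a.coeff (n - (k : ℤ))))
    (bddBelow_of_lt a.order fun n hn => by
      refine (finsum_congr fun k => ?_).trans finsum_zero
      have h' : n - (k : ℤ) < a.order := by omega
      simp [HahnSeries.coeff_eq_zero_of_lt_order h'])

/-- The integral part `H_- = H - H_+`, i.e. the part of strictly negative order in `D`. -/
def negPart (a : PsDO) : PsDO :=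
  HahnSeries.ofSuppBddBelow (fun n : ℤ => if 0 < n then a.coeff n else 0)
    (bddBelow_of_lt 0 fun n hn => by
      rw [if_neg (by omega)])

/-- Partial differentiation of all the coefficients in the variable with index `i`. -/
def delCoeff (i : ℕ) (a : PsDO) : PsDO := a.map (del i)

/-! ### Wave functions and the KP hierarchy -/

/-- `exp (ε (x z + ∑_{i ≥ 1} t_i z ^ i))`, expanded in powers of `x, t_1, t_2, …` with coefficients
in `ℂ((1/z))`. -/
def expKP (ε : ℤˣ) : MvPowerSeries ℕ Lau := fun m =>
  m.prod fun i k => ((k.factorial : ℂ)⁻¹) • (((ε : ℤ) : ℂ) • zpow (if i = 0 then 1 else (i : ℤ))) ^ k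

/-- The factor `∑ a_n (ε z) ^ (-n)` by which the operator `∑ a_n D ^ (-n)` multiplies
`exp (ε x z)`, expanded in powers of `x, t_1, t_2, …` with coefficients in `ℂ((1/z))`. -/
def symbol (ε : ℤˣ) (a : PsDO) : MvPowerSeries ℕ Lau := fun m =>
  HahnSeries.ofSuppBddBelow
    (fun n : ℤ => (((ε ^ n : ℤˣ) : ℤ) : ℂ) * MvPowerSeries.coeff m (a.coeff n))
    (bddBelow_of_lt a.order fun n hn => by
      simp [HahnSeries.coeff_eq_zero_of_lt_order hn])

/-- The pseudo-differential operator `a` applied to `exp (ε (x z + ∑_{i ≥ 1} t_i z ^ i))`. -/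
def actExp (ε : ℤˣ) (a : PsDO) : MvPowerSeries ℕ Lau := symbol ε a * expKP ε

/-- A solution of the KP hierarchy, given by its dressing operator `S = 1 + ∑_{j ≥ 1} w_j D ^ (-j)`
(the wave operator is `S exp (∑ t_i D ^ i)`) with coefficients `w_j ∈ ℂ[[x, t_1, t_2, …]]`, subject
to the evolution equations `∂_{t_i} S = - (L ^ i)_- S`, where `L ^ i = S D ^ i S⁻¹`. -/
@[ext]
structure Solution where
  /-- The dressing operator. -/
  S : PsDO
  /-- Its inverse. -/
  Sinv : PsDO
  coeff_zero : S.coeff 0 = 1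
  coeff_neg : ∀ n : ℤ, n < 0 → S.coeff n = 0
  comp_inv : comp S Sinv = Dpow 0
  inv_comp : comp Sinv S = Dpow 0
  evol : ∀ i : ℕ, 1 ≤ i →
    delCoeff i S = - comp (negPart (comp (comp S (Dpow (i : ℤ))) Sinv)) S

/-- The wave function `Ψ^+ = S exp (x z + ∑ t_i z ^ i)` and the adjoint wave function
`Ψ^- = (S⁻¹)^* exp (- x z - ∑ t_i z ^ i)`. -/
def Solution.wave (K : Solution) (ε : ℤˣ) : MvPowerSeries ℕ Lau :=
  if ε = 1 then actExp 1 K.S else actExp (-1) (adj K.Sinv)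

/-- The restriction of a formal power series in `x, t_1, t_2, …` to `t = 0`. -/
def atTimeZero (F : MvPowerSeries ℕ Lau) : PowerSeries Lau :=
  PowerSeries.mk fun n => MvPowerSeries.coeff (Finsupp.single 0 n) F

/-- `Ψ^ε(x, 0; z)`, as a formal power series in `x` with coefficients in `ℂ((1/z))`. -/
def Solution.waveX (K : Solution) (ε : ℤˣ) : PowerSeries Lau := atTimeZero (K.wave ε)

/-- The derivative `∂_x` of formal power series in `x` with coefficients in `ℂ((1/z))`. -/
def dX (F : PowerSeries Lau) : PowerSeries Lau := PowerSeries.derivative Lau F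

/-- The planes `W^ε = span_{i ≥ 0} {D ^ i Ψ^ε(x, 0; z)}`, the derivatives being taken at
`x = 0`. -/
def Solution.plane (K : Solution) (ε : ℤˣ) : Submodule ℂ Lau :=
  Submodule.span ℂ (Set.range fun i : ℕ => PowerSeries.constantCoeff (dX^[i] (K.waveX ε)))

/-- An operator in `z` acting on a formal power series in `x`, coefficient by coefficient. -/
def actZ (T : Module.End ℂ Lau) (F : PowerSeries Lau) : PowerSeries Lau :=
  PowerSeries.mk fun n => T (PowerSeries.coeff n F)

end KP

end

noncomputable section

namespace KP

/-! Everything rests on one transversality: a point of `Gr` is a linear complement of the series in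
negative powers of `z` (`VB 1`). Hence a point of `Gr` contains exactly one `1 + O(1/z)`, nested
points coincide, and any element of order at least 1 is zero (`eq_zero_of_mem_gr`).

The planes. On series of leading term `z ^ (-n)`, `A ^ p - z ^ p` drops the degree by one and
multiplies the leading coefficient by `-ε n` (`opA_pow_self_sub`). So `A ^ p φ = z ^ p φ` is a
triangular system with invertible diagonal for `n ≥ 1` and a unique solution `φ = 1 + O(1/z)`. In a
stable plane the element `g = 1 + O(1/z)` has `A ^ p g - z ^ p g` in the plane and of order at least
1, so it vanishes and `g = φ`; the plane contains the span of the `A ^ i φ`, another point of `Gr`,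
and equals it. That span is stable under `z ^ p` because `[A, z ^ p] = ε` (`gr_stable_iff`).

Sato's theorem. For a plane `V`, transversality yields exactly one `w = 1 + O(1/z)` with all
coefficients of `w exp(xz + ∑ t_i z ^ i)` in `V`. It is the symbol of a dressing operator `S`. The
defect `∂_i S + (L ^ i)_- S` has symbol of order at least 1, and applied to the exponential it gives
`∂_i Ψ - (L ^ i)_+ Ψ`, with coefficients in `V`; so it is zero. Conversely, the evolution equations
force all coefficients of a wave function into its plane (`Solution.coeffsIn`), which gives
uniqueness.

The adjoint. The residue in `z` of `(a e^{xz})(b^* e^{-xz})` is the residue in `D` of `a b`; with `a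
= D ^ i S`, `b = S⁻¹` it vanishes, so the adjoint plane is the orthogonal complement of the plane
(`Solution.plane_neg_one`). As `A^{-ε}` is the transpose of `A^ε` and `z ^ p` is its own, this
complement is stable, and uniqueness identifies it.

The equation in `x`. `A Ψ - ε ∂_x Ψ` has coefficients in the plane and is `u e^{ε x z}`, with `u` of
order at least 1 once `p ≥ 2`; again `u = 0` (`actZ_opA_eq_dX`). -/

/-! ### Order filtration on Laurent series -/

/-- All coefficients of index less than `N` vanish. -/
def VB {R : Type*} [Zero R] (N : ℤ) (a : LaurentSeries R) : Prop := ∀ n, n < N → a.coeff n = 0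

section VB

variable {R : Type*}

theorem VB.mono [Zero R] {M N : ℤ} {a : LaurentSeries R} (h : VB N a) (hMN : M ≤ N) : VB M a :=
  fun n hn => h n (hn.trans_le hMN)

theorem vb_order [Zero R] (a : LaurentSeries R) : VB a.order a :=
  fun _ hn => HahnSeries.coeff_eq_zero_of_lt_order hn

theorem vb_zero [Zero R] (N : ℤ) : VB N (0 : LaurentSeries R) := fun _ _ => rfl

theorem vb_single [Zero R] (N : ℤ) (r : R) : VB N (HahnSeries.single N r : LaurentSeries R) :=
  fun _ hn => HahnSeries.coeff_single_of_ne hn.ne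

theorem VB.add [AddMonoid R] {N : ℤ} {a b : LaurentSeries R} (ha : VB N a) (hb : VB N b) :
    VB N (a + b) := fun n hn => by simp [ha n hn, hb n hn]

theorem VB.neg [AddGroup R] {N : ℤ} {a : LaurentSeries R} (ha : VB N a) : VB N (-a) :=
  fun n hn => by simp [ha n hn]

theorem VB.sub [AddGroup R] {N : ℤ} {a b : LaurentSeries R} (ha : VB N a) (hb : VB N b) :
    VB N (a - b) := fun n hn => by simp [ha n hn, hb n hn]

theorem VB.smul [Semiring R] {N : ℤ} {a : LaurentSeries R} (c : R) (ha : VB N a) : VB N (c • a) :=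
  fun n hn => by simp [ha n hn]

theorem VB.sum [AddCommMonoid R] {N : ℤ} {ι : Type*} {s : Finset ι} {f : ι → LaurentSeries R}
    (h : ∀ i ∈ s, VB N (f i)) : VB N (∑ i ∈ s, f i) := fun n hn => by
  rw [HahnSeries.coeff_sum]
  exact Finset.sum_eq_zero fun i hi => h i hi n hn

/-- The index set may be any finite set that is large enough, so that several products can be summed
over a common set and compared termwise; `comp_coeff_eq_sum` serves the same purpose for operators.
-/
theorem coeff_mul_eq_sum [Semiring R] {A B : ℤ} {a b : LaurentSeries R} (ha : VB A a)
    (hb : VB B b) (n : ℤ) (s : Finset ℤ) (hs : ∀ i, A ≤ i → B ≤ n - i → i ∈ s) :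
    (a * b).coeff n = ∑ i ∈ s, a.coeff i * b.coeff (n - i) := by
  rw [HahnSeries.coeff_mul]
  refine Finset.sum_of_injOn Prod.fst ?_ ?_ ?_ ?_
  · rintro ⟨i, j⟩ hi ⟨i', j'⟩ hj h
    simp only [Finset.mem_coe, Finset.mem_antidiagonal, HahnSeries.mem_support] at hi hj h
    ext <;> simp <;> omega
  · rintro ⟨i, j⟩ hi
    simp only [Finset.mem_coe, Finset.mem_antidiagonal, HahnSeries.mem_support] at hi ⊢
    refine hs i (not_lt.mp fun h => hi.1 (ha _ h)) (not_lt.mp fun h => hi.2.1 (hb _ ?_))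
    omega
  · intro i _ hi
    by_contra h
    refine hi ⟨(i, n - i), ?_, rfl⟩
    simp only [Finset.mem_coe, Finset.mem_antidiagonal, HahnSeries.mem_support]
    exact ⟨left_ne_zero_of_mul h, right_ne_zero_of_mul h, by ring⟩
  · rintro ⟨i, j⟩ hi
    simp only [Finset.mem_antidiagonal] at hi
    rw [← hi.2.2]
    simp

theorem VB.mul [Semiring R] {A B : ℤ} {a b : LaurentSeries R} (ha : VB A a) (hb : VB B b) :
    VB (A + B) (a * b) := fun n hn => by
  rw [coeff_mul_eq_sum ha hb n ∅ (fun i h1 h2 => by omega), Finset.sum_empty]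

/-- An additive property of Laurent series which holds for monomials and for all series of
sufficiently high order holds for all series. -/
theorem vb_induction [AddCommGroup R] {Q : LaurentSeries R → Prop}
    (hadd : ∀ a b, Q a → Q b → Q (a + b)) (hsingle : ∀ n r, Q (HahnSeries.single n r)) (N : ℤ)
    (hN : ∀ a, VB N a → Q a) (a : LaurentSeries R) : Q a := by
  suffices h : ∀ k : ℕ, ∀ a, VB (N - k) a → Q a from
    h (N - a.order).toNat a ((vb_order a).mono (by omega))
  intro k
  induction k with
  | zero => intro a ha; exact hN a (by simpa using ha)
  | succ k ih =>
    intro a ha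
    set m : ℤ := N - ((k + 1 : ℕ) : ℤ) with hm
    have : a = HahnSeries.single m (a.coeff m) + (a - HahnSeries.single m (a.coeff m)) := by abel
    rw [this]
    refine hadd _ _ (hsingle _ _) (ih _ fun n hn => ?_)
    by_cases h : n = m
    · simp [h]
    · rw [HahnSeries.coeff_sub, HahnSeries.coeff_single_of_ne h, ha n (by omega), sub_zero]

theorem eq_zero_of_vb [Zero R] {a : LaurentSeries R} (h : ∀ N : ℕ, VB N a) : a = 0 := by
  ext1; funext n
  exact h (n + 1).toNat n (by omega)

/-- A sequence of Laurent series which stabilizes coefficientwise has a limit. -/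
theorem exists_vb_limit [AddCommGroup R] (f : ℕ → LaurentSeries R)
    (hf : ∀ N : ℕ, VB (N + 1 : ℤ) (f (N + 1) - f N)) :
    ∃ g : LaurentSeries R, ∀ N : ℕ, VB (N + 1 : ℤ) (g - f N) := by
  have h : ∀ N k : ℕ, VB (N + 1 : ℤ) (f (N + k) - f N) := by
    intro N k
    induction k with
    | zero => simpa using vb_zero _
    | succ k ih =>
      have := ((hf (N + k)).mono (by push_cast; omega : (N + 1 : ℤ) ≤ ((N + k : ℕ) : ℤ) + 1)).add ih
      rwa [sub_add_sub_cancel] at this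
  -- The coefficient of index `n ≥ 0` no longer changes after stage `n`; those of negative index
  -- never change, and `toNat` reads them off `f 0`.
  refine ⟨HahnSeries.ofSuppBddBelow (fun n : ℤ => (f n.toNat).coeff n)
    (bddBelow_of_lt (min 0 (f 0).order) fun n hn => ?_), fun N n hn => ?_⟩
  · rw [show n.toNat = 0 by omega]
    exact vb_order _ n (by omega)
  · rw [HahnSeries.coeff_sub, HahnSeries.coeff_ofSuppBddBelow]
    obtain ⟨k, hk⟩ : ∃ k, N = n.toNat + k := ⟨N - n.toNat, by omega⟩
    have := h n.toNat k n (by omega)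
    rw [HahnSeries.coeff_sub, ← hk] at this
    rw [← neg_sub, this, neg_zero]

/-- Solution of a triangular system of equations for the coefficients of a Laurent series. -/
theorem exists_triangular_solution [AddCommGroup R] (T : LaurentSeries R →+ LaurentSeries R) (s : ℤ)
    (hT : ∀ n a, VB n a → VB (n + s) (T a))
    (hsurj : ∀ n : ℤ, 1 ≤ n → ∀ r, ∃ c, (T (HahnSeries.single n c)).coeff (n + s) = r)
    (y f₀ : LaurentSeries R) (h₀ : VB (1 + s) (T f₀ - y)) : ∃ f, VB 1 (f - f₀) ∧ T f = y := by
  have step : ∀ (N : ℕ) (f : LaurentSeries R), ∃ g, VB (N + 1 : ℤ) (g - f) ∧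
      (VB (N + 1 + s) (T f - y) → VB (N + 2 + s) (T g - y)) := by
    intro N f
    -- A monomial of index `N + 1` first affects `T f` at index `N + 1 + s`; it is chosen to kill
    -- the error there and leaves the lower, already correct, coefficients alone.
    obtain ⟨c, hc⟩ := hsurj (N + 1) (by omega) (-(T f - y).coeff (N + 1 + s))
    refine ⟨f + HahnSeries.single (N + 1 : ℤ) c, by simpa using vb_single _ c, fun h n hn => ?_⟩
    rw [map_add, add_sub_right_comm, HahnSeries.coeff_add]
    rcases lt_or_eq_of_le (show n ≤ N + 1 + s by omega) with hlt | rfl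
    · rw [h n hlt, hT _ _ (vb_single _ c) n hlt, add_zero]
    · rw [hc, add_neg_cancel]
  choose g hg hg' using step
  let F : ℕ → LaurentSeries R := fun N => Nat.rec f₀ (fun N f => g N f) N
  have hF : ∀ N : ℕ, VB (N + 1 + s) (T (F N) - y) := by
    intro N
    induction N with
    | zero => simpa using! h₀
    | succ N ih =>
      have := hg' N (F N) ih
      rwa [show ((N + 1 : ℕ) : ℤ) + 1 + s = N + 2 + s by push_cast; ring]
  obtain ⟨f, hf⟩ := exists_vb_limit F fun N => hg N (F N)
  refine ⟨f, by simpa using! hf 0, ?_⟩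
  rw [← sub_eq_zero]
  ext1; funext n
  have h1 := hF (n - s).toNat n (by omega)
  have h2 := hT _ _ (hf (n - s).toNat) n (by omega)
  rw [map_sub] at h2
  rw [← sub_add_sub_cancel (T f) (T (F (n - s).toNat)) y, HahnSeries.coeff_add, h1, h2, add_zero,
    HahnSeries.coeff_zero]

end VB

/-! ### Composition of pseudo-differential operators -/

theorem del_mul (i : ℕ) (f g : Fun) : del i (f * g) = f * del i g + g * del i f := by
  simp [del]

theorem del_pow_mul (k : ℕ) (f g : Fun) : ((del 0) ^ k) (f * g) =
    ∑ q ∈ Finset.HasAntidiagonal.antidiagonal k, k.choose q.1 • (((del 0) ^ q.1) f * ((del 0) ^ q.2) g) := by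
  induction k with
  | zero => simp
  | succ k ih =>
    rw [Finset.sum_antidiagonal_choose_succ_nsmul
      (fun i j => ((del 0) ^ i) f * ((del 0) ^ j) g) k, pow_succ', Module.End.mul_apply, ih,
      map_sum, ← Finset.sum_add_distrib]
    refine Finset.sum_congr rfl fun q hq => ?_
    rw [Finset.HasAntidiagonal.mem_antidiagonal] at hq
    rw [map_nsmul, del_mul, pow_succ', pow_succ', Module.End.mul_apply, Module.End.mul_apply,
      smul_add, Nat.choose_symm_of_eq_add (by omega : k = q.2 + q.1), mul_comm (((del 0) ^ q.2) g)]

theorem del_pow_one (k : ℕ) (hk : k ≠ 0) : ((del 0) ^ k) (1 : Fun) = 0 := by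
  obtain ⟨k, rfl⟩ := Nat.exists_eq_succ_of_ne_zero hk
  rw [pow_succ, Module.End.mul_apply]
  simp [del]

theorem comp_coeff_eq_sum {A B : ℤ} {a b : PsDO} (ha : VB A a) (hb : VB B b) (n : ℤ)
    (s : Finset (ℤ × ℕ)) (hs : ∀ q : ℤ × ℕ, A ≤ q.1 → B ≤ n - q.1 - (q.2 : ℤ) → q ∈ s) :
    (comp a b).coeff n = ∑ q ∈ s, Ring.choose (-q.1) q.2 •
        (a.coeff q.1 * ((del 0) ^ q.2) (b.coeff (n - q.1 - (q.2 : ℤ)))) := by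
  refine finsum_eq_sum_of_support_subset _ fun q hq => ?_
  by_contra h
  have : q.1 < A ∨ n - q.1 - (q.2 : ℤ) < B := by
    by_contra! h'
    exact h (hs q h'.1 h'.2)
  apply hq
  rcases this with hlt | hlt
  · simp [ha _ hlt]
  · simp [hb _ hlt]

/-- A finite set of indices which contributes to the coefficient of index `n` of a composition of
operators of orders at least `A` and `B`. -/
def compBox (A B n : ℤ) : Finset (ℤ × ℕ) :=
  Finset.Icc A (n - B) ×ˢ Finset.range (n - A - B + 1).toNat

theorem mem_compBox {A B n : ℤ} (q : ℤ × ℕ) (h1 : A ≤ q.1) (h2 : B ≤ n - q.1 - (q.2 : ℤ)) :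
    q ∈ compBox A B n := by
  simp only [compBox, Finset.mem_product, Finset.mem_Icc, Finset.mem_range]
  omega

theorem comp_add_left (a a' b : PsDO) : comp (a + a') b = comp a b + comp a' b := by
  ext1; funext n
  have h1 := (vb_order a).mono (min_le_left a.order a'.order)
  have h2 := (vb_order a').mono (min_le_right a.order a'.order)
  rw [HahnSeries.coeff_add, comp_coeff_eq_sum h1 (vb_order b) n _ mem_compBox,
    comp_coeff_eq_sum h2 (vb_order b) n _ mem_compBox,
    comp_coeff_eq_sum (h1.add h2) (vb_order b) n _ mem_compBox, ← Finset.sum_add_distrib]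
  exact Finset.sum_congr rfl fun q _ => by rw [HahnSeries.coeff_add, add_mul, smul_add]

theorem comp_add_right (a b b' : PsDO) : comp a (b + b') = comp a b + comp a b' := by
  ext1; funext n
  have h1 := (vb_order b).mono (min_le_left b.order b'.order)
  have h2 := (vb_order b').mono (min_le_right b.order b'.order)
  rw [HahnSeries.coeff_add, comp_coeff_eq_sum (vb_order a) h1 n _ mem_compBox,
    comp_coeff_eq_sum (vb_order a) h2 n _ mem_compBox,
    comp_coeff_eq_sum (vb_order a) (h1.add h2) n _ mem_compBox, ← Finset.sum_add_distrib]
  exact Finset.sum_congr rfl fun q _ => by rw [HahnSeries.coeff_add, map_add, mul_add, smul_add]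

theorem VB.comp {A B : ℤ} {a b : PsDO} (ha : VB A a) (hb : VB B b) : VB (A + B) (comp a b) :=
  fun n hn => by
    rw [comp_coeff_eq_sum ha hb n ∅ (fun i h1 h2 => by omega), Finset.sum_empty]

theorem comp_single_left_coeff {B : ℤ} {b : PsDO} (hb : VB B b) (i : ℤ) (f : Fun) (n : ℤ) (M : ℕ)
    (hM : n - i - B < M) : (comp (HahnSeries.single i f) b).coeff n =
      ∑ k ∈ Finset.range M, Ring.choose (-i) k • (f * ((del 0) ^ k) (b.coeff (n - i - k))) := by
  have ha : VB i (HahnSeries.single i f : PsDO) := vb_single i f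
  rw [comp_coeff_eq_sum ha hb n (Finset.Icc i (n - B) ×ˢ Finset.range M) (fun q h1 h2 => by
    simp only [Finset.mem_product, Finset.mem_Icc, Finset.mem_range]; omega), Finset.sum_product]
  by_cases h : i ∈ Finset.Icc i (n - B)
  · rw [Finset.sum_eq_single i _ (fun h' => absurd h h')]
    · simp
    · intro j _ hj
      exact Finset.sum_eq_zero fun k _ => by simp [HahnSeries.coeff_single_of_ne hj]
  · have h' : n - B < i := by simpa using h
    rw [Finset.Icc_eq_empty (by omega), Finset.sum_empty]
    symm
    refine Finset.sum_eq_zero fun k _ => ?_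
    rw [hb _ (by omega)]
    simp

theorem comp_single_right_coeff {A : ℤ} {a : PsDO} (ha : VB A a) (l : ℤ) (h : Fun) (n : ℤ) (M : ℕ)
    (hM : n - l - A < M) : (comp a (HahnSeries.single l h)).coeff n =
      ∑ k ∈ Finset.range M,
        Ring.choose (-(n - l - k)) k • (a.coeff (n - l - k) * ((del 0) ^ k) h) := by
  have hs : ∀ q : ℤ × ℕ, q ∉ (Finset.range M).image (fun k : ℕ => (n - l - (k : ℤ), k)) →
      Ring.choose (-q.1) q.2 • (a.coeff q.1 *
        ((del 0) ^ q.2) ((HahnSeries.single l h : PsDO).coeff (n - q.1 - (q.2 : ℤ)))) = 0 := by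
    rintro ⟨i, k⟩ hq
    by_cases hi : n - i - (k : ℤ) = l
    · have : ¬ k < M := fun hk => hq (Finset.mem_image.mpr
        ⟨k, Finset.mem_range.mpr hk, Prod.ext (by simp; omega) rfl⟩)
      simp [ha i (by omega)]
    · simp [HahnSeries.coeff_single_of_ne hi]
  refine (finsum_eq_sum_of_support_subset _ fun q hq => ?_).trans
    ((Finset.sum_image (s := Finset.range M) (g := fun k : ℕ => (n - l - (k : ℤ), k))
      fun k _ k' _ hk => (Prod.ext_iff.mp hk).2).trans ?_)
  · by_contra h'
    exact hq (hs q h')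
  · refine Finset.sum_congr rfl fun k _ => ?_
    simp only
    rw [show n - (n - l - (k : ℤ)) - k = l by ring, HahnSeries.coeff_single_same]

theorem comp_single_single_coeff (i j : ℤ) (f g : Fun) (N : ℕ) :
    (comp (HahnSeries.single i f) (HahnSeries.single j g)).coeff (i + j + N) =
      Ring.choose (-i) N • (f * ((del 0) ^ N) g) := by
  rw [comp_single_left_coeff (vb_single j g) i f _ (N + 1) (by push_cast; omega),
    Finset.sum_eq_single N]
  · rw [show i + j + (N : ℤ) - i - N = j by ring, HahnSeries.coeff_single_same]
  · intro k _ hk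
    rw [HahnSeries.coeff_single_of_ne (by omega)]
    simp
  · simp

/-- Trinomial revision `binom(-i, u + v) binom(u + v, u) = binom(-i, u) binom(-i - u, v)`, followed
by Vandermonde's convolution. -/
theorem choose_vandermonde (i j : ℤ) (u w : ℕ) :
    ∑ q ∈ Finset.HasAntidiagonal.antidiagonal w,
      Ring.choose (-i) (u + q.1) * (u + q.1).choose u * Ring.choose (-j) q.2 =
    Ring.choose (-i) u * Ring.choose (-i - j - u) w := by
  rw [show -i - j - (u : ℤ) = (-i - u) + (-j) by ring, Ring.add_choose_eq w (Commute.all _ _),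
    Finset.mul_sum]
  refine Finset.sum_congr rfl fun q _ => ?_
  have h := Ring.choose_add_smul_choose (-i - u : ℤ) q.1 u
  rw [sub_add_cancel, nsmul_eq_mul, add_comm q.1 u] at h
  linear_combination Ring.choose (-j) q.2 * h

theorem sum_antidiagonal_assoc {M : Type*} [AddCommMonoid M] (N : ℕ) (F : ℕ → ℕ → ℕ → M) :
    ∑ q ∈ Finset.HasAntidiagonal.antidiagonal N,
      ∑ r ∈ Finset.HasAntidiagonal.antidiagonal q.1, F r.1 r.2 q.2 =
    ∑ q ∈ Finset.HasAntidiagonal.antidiagonal N,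
      ∑ r ∈ Finset.HasAntidiagonal.antidiagonal q.2, F q.1 r.1 r.2 := by
  rw [Finset.sum_sigma', Finset.sum_sigma']
  refine Finset.sum_nbij' (fun x => ⟨(x.2.1, x.2.2 + x.1.2), (x.2.2, x.1.2)⟩)
    (fun x => ⟨(x.1.1 + x.2.1, x.2.2), (x.1.1, x.2.1)⟩) ?_ ?_ ?_ ?_ ?_ <;>
  rintro ⟨⟨a, b⟩, ⟨c, d⟩⟩ <;> simp <;> omega

theorem comp_assoc_single (i j l : ℤ) (f g h : Fun) :
    comp (comp (HahnSeries.single i f) (HahnSeries.single j g)) (HahnSeries.single l h) =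
    comp (HahnSeries.single i f) (comp (HahnSeries.single j g) (HahnSeries.single l h)) := by
  have hX := (vb_single i f).comp (vb_single j g)
  have hY := (vb_single j g).comp (vb_single l h)
  ext1; funext n
  by_cases hn : n < i + j + l
  · rw [hX.comp (vb_single l h) n hn, (vb_single i f).comp hY n (by omega)]
  obtain ⟨N, rfl⟩ : ∃ N : ℕ, n = i + j + l + N := ⟨(n - (i + j + l)).toNat, by omega⟩
  -- Both sides are sorted by the number `u` of derivatives falling on `g` and `w` on `h`. On the
  -- right, `q.2` of the latter come from `D ^ (-j)` and `q.1` from `D ^ (-i)` acting on the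
  -- product; summing over this split is `choose_vandermonde`.
  have key : ∀ u w : ℕ, u + w = N →
      (∑ q ∈ Finset.HasAntidiagonal.antidiagonal w,
        (Ring.choose (-i) (u + q.1) * (u + q.1).choose u * Ring.choose (-j) q.2) •
        (f * (((del 0) ^ u) g * ((del 0) ^ (q.1 + q.2)) h))) =
      Ring.choose (-(i + j + l + N - l - w)) w • ((comp (HahnSeries.single i f)
        (HahnSeries.single j g)).coeff (i + j + l + N - l - w) * ((del 0) ^ w) h) := by
    intro u w huw
    rw [show i + j + l + (N : ℤ) - l - w = i + j + u by omega, comp_single_single_coeff,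
      smul_mul_assoc, smul_smul, mul_assoc, mul_comm (Ring.choose _ w),
      show -(i + j + (u : ℤ)) = -i - j - u by ring, ← choose_vandermonde, Finset.sum_smul]
    exact Finset.sum_congr rfl fun q hq => by
      rw [Finset.HasAntidiagonal.mem_antidiagonal.mp hq]
  rw [comp_single_right_coeff hX l h _ (N + 1) (by push_cast; omega),
    comp_single_left_coeff hY i f _ (N + 1) (by push_cast; omega)]
  have hL := Finset.Nat.sum_antidiagonal_eq_sum_range_succ_mk (fun q : ℕ × ℕ =>
    Ring.choose (-(i + j + l + N - l - q.1)) q.1 • ((comp (HahnSeries.single i f)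
        (HahnSeries.single j g)).coeff (i + j + l + N - l - q.1) * ((del 0) ^ q.1) h)) N
  have hR := Finset.Nat.sum_antidiagonal_eq_sum_range_succ_mk (fun q : ℕ × ℕ =>
    Ring.choose (-i) q.1 • (f * ((del 0) ^ q.1) ((comp (HahnSeries.single j g)
        (HahnSeries.single l h)).coeff (i + j + l + N - i - q.1)))) N
  refine hL.symm.trans (Eq.trans ?_ hR)
  rw [← Finset.Nat.sum_antidiagonal_swap]
  refine (Finset.sum_congr rfl fun q hq =>
    (key q.1 q.2 (Finset.HasAntidiagonal.mem_antidiagonal.mp hq)).symm).trans ?_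
  rw [← sum_antidiagonal_assoc N (fun u v s =>
    (Ring.choose (-i) (u + v) * (u + v).choose u * Ring.choose (-j) s) •
        (f * (((del 0) ^ u) g * ((del 0) ^ (v + s)) h)))]
  refine Finset.sum_congr rfl fun q hq => ?_
  have hq' := Finset.HasAntidiagonal.mem_antidiagonal.mp hq
  rw [show i + j + l + (N : ℤ) - i - q.1 = j + l + q.2 by omega, comp_single_single_coeff,
    map_zsmul, del_pow_mul, mul_smul_comm, smul_smul, Finset.mul_sum, Finset.smul_sum]
  refine Finset.sum_congr rfl fun r hr => ?_
  rw [Finset.HasAntidiagonal.mem_antidiagonal.mp hr, mul_smul_comm, ← natCast_zsmul, smul_smul,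
    pow_add, Module.End.mul_apply]
  congr 1
  ring

/-- For a fixed coefficient, operators of high enough order contribute nothing to either side, so
`vb_induction` in `c`, then `b`, then `a` reduces to monomials. -/
theorem comp_assoc (a b c : PsDO) : comp (comp a b) c = comp a (comp b c) := by
  ext1; funext n
  revert a b c
  have h1 : ∀ i f j g c, (comp (comp (HahnSeries.single i f) (HahnSeries.single j g)) c).coeff n =
      (comp (HahnSeries.single i f) (comp (HahnSeries.single j g) c)).coeff n := by
    intro i f j g
    refine vb_induction (fun c c' hc hc' => ?_) (fun l h => ?_) (n + 1 - i - j) (fun c hc => ?_)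
    · simp only [comp_add_right, HahnSeries.coeff_add, hc, hc']
    · rw [comp_assoc_single]
    · rw [((vb_single i f).comp (vb_single j g)).comp hc n (by omega),
        (vb_single i f).comp ((vb_single j g).comp hc) n (by omega)]
  have h2 : ∀ i f b c, (comp (comp (HahnSeries.single i f) b) c).coeff n =
      (comp (HahnSeries.single i f) (comp b c)).coeff n := by
    intro i f b c
    revert b
    refine vb_induction (fun b b' hb hb' => ?_) (fun l h => ?_) (n + 1 - i - c.order)
      (fun b hb => ?_)
    · simp only [comp_add_right, comp_add_left, HahnSeries.coeff_add, hb, hb']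
    · rw [h1]
    · rw [((vb_single i f).comp hb).comp (vb_order c) n (by omega),
        (vb_single i f).comp (hb.comp (vb_order c)) n (by omega)]
  intro a b c
  revert a
  refine vb_induction (fun a a' ha ha' => ?_) (fun l h => ?_) (n + 1 - b.order - c.order)
    (fun a ha => ?_)
  · simp only [comp_add_left, HahnSeries.coeff_add, ha, ha']
  · rw [h2]
  · rw [(ha.comp (vb_order b)).comp (vb_order c) n (by omega),
      ha.comp ((vb_order b).comp (vb_order c)) n (by omega)]

theorem comp_Dpow_right_coeff (a : PsDO) (i n : ℤ) : (comp a (Dpow i)).coeff n = a.coeff (n + i) := by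
  rw [Dpow, comp_single_right_coeff (vb_order a) (-i) 1 n ((n + i - a.order).toNat + 1)
    (by push_cast; omega), Finset.sum_eq_single 0]
  · simp
  · intro k _ hk
    simp [del_pow_one k hk]
  · simp

theorem comp_single_left_coeff' (a : PsDO) (i n : ℤ) (f : Fun) :
    (comp (HahnSeries.single i f) a).coeff n = f * (comp (Dpow (-i)) a).coeff n := by
  have h : n - i - a.order < ((n - i - a.order).toNat + 1 : ℕ) := by push_cast; omega
  rw [comp_single_left_coeff (vb_order a) i f n _ h, Dpow, neg_neg,
    comp_single_left_coeff (vb_order a) i 1 n _ h, Finset.mul_sum]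
  exact Finset.sum_congr rfl fun k _ => by rw [one_mul, mul_smul_comm]

theorem Dpow_zero_comp (a : PsDO) : comp (Dpow 0) a = a := by
  ext1; funext n
  rw [Dpow, neg_zero, comp_single_left_coeff (vb_order a) 0 1 n ((n - a.order).toNat + 1)
    (by push_cast; omega), Finset.sum_eq_single 0]
  · simp
  · intro k _ hk
    simp [Ring.choose_zero_pos ℤ (Nat.pos_of_ne_zero hk)]
  · simp

theorem comp_Dpow_zero (a : PsDO) : comp a (Dpow 0) = a := by
  ext1; funext n
  rw [comp_Dpow_right_coeff, add_zero]

theorem Dpow_one_comp_coeff (a : PsDO) (n : ℤ) :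
    (comp (Dpow 1) a).coeff n = a.coeff (n + 1) + del 0 (a.coeff n) := by
  rw [Dpow, comp_single_left_coeff (vb_order a) (-1) 1 n ((n + 1 - a.order).toNat + 2)
    (by push_cast; omega), Finset.sum_range_succ', Finset.sum_range_succ']
  have h : ∀ k : ℕ, Ring.choose (1 : ℤ) (k + 1 + 1) = 0 := fun k => by
    rw [← Nat.cast_one, Ring.choose_natCast, Nat.choose_eq_zero_of_lt (by omega), Nat.cast_zero]
  simp only [neg_neg, h, zero_smul, Finset.sum_const_zero, zero_add]
  simp [add_comm]

theorem Dpow_comp_Dpow (i j : ℤ) : comp (Dpow i) (Dpow j) = Dpow (i + j) := by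
  ext1; funext n
  rw [comp_Dpow_right_coeff, Dpow, Dpow]
  by_cases h : n = -(i + j)
  · rw [h, HahnSeries.coeff_single_same, show -(i + j) + j = -i by ring,
      HahnSeries.coeff_single_same]
  · rw [HahnSeries.coeff_single_of_ne h, HahnSeries.coeff_single_of_ne (by omega)]

/-! ### Operators `1 + O(D⁻¹)` -/

/-- The operator has the form `1 + O(D⁻¹)`. -/
def IsMonicOp (a : PsDO) : Prop := a.coeff 0 = 1 ∧ VB 0 a

theorem isMonicOp_iff {a : PsDO} : IsMonicOp a ↔ VB 1 (a - Dpow 0) := by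
  constructor
  · rintro ⟨h0, h⟩ n hn
    rw [HahnSeries.coeff_sub, Dpow, neg_zero]
    rcases eq_or_ne n 0 with rfl | hn'
    · simp [h0]
    · rw [h n (by omega), HahnSeries.coeff_single_of_ne hn', sub_zero]
  · intro h
    have h' : ∀ n < 1, a.coeff n = (HahnSeries.single 0 (1 : Fun) : PsDO).coeff n := fun n hn => by
      have := h n hn
      rwa [HahnSeries.coeff_sub, Dpow, neg_zero, sub_eq_zero] at this
    exact ⟨by rw [h' 0 one_pos, HahnSeries.coeff_single_same], fun n hn => by
      rw [h' n (by omega), HahnSeries.coeff_single_of_ne hn.ne]⟩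

/-- Composition with a monic operator on the left preserves the leading coefficient, so the equation
for the inverse is triangular. -/
theorem IsMonicOp.exists_right_inv {a : PsDO} (ha : IsMonicOp a) :
    ∃ b, IsMonicOp b ∧ comp a b = Dpow 0 := by
  obtain ⟨b, hb, hab⟩ := exists_triangular_solution
    (AddMonoidHom.mk' (comp a) (comp_add_right a)) 0
    (fun n b hb => by simpa [add_comm] using ha.2.comp hb)
    (fun n _ r => ⟨r, by
      rw [AddMonoidHom.mk'_apply, comp_single_right_coeff ha.2 n r _ 1 (by push_cast; omega)]
      simp [ha.1]⟩) (Dpow 0) (Dpow 0) (by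
      rw [AddMonoidHom.mk'_apply, comp_Dpow_zero, add_zero]
      exact isMonicOp_iff.mp ha)
  exact ⟨b, isMonicOp_iff.mpr hb, hab⟩

theorem left_inv_eq_right_inv {a b c : PsDO} (h : comp b a = Dpow 0) (h' : comp a c = Dpow 0) :
    b = c := by
  rw [← comp_Dpow_zero b, ← h', ← comp_assoc, h, Dpow_zero_comp]

theorem IsMonicOp.exists_inv {a : PsDO} (ha : IsMonicOp a) :
    ∃ b, IsMonicOp b ∧ comp a b = Dpow 0 ∧ comp b a = Dpow 0 := by
  obtain ⟨b, hb, hab⟩ := ha.exists_right_inv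
  -- `a` is a left inverse of `b` and `c` a right inverse, so `c = a` and `b` is two-sided.
  obtain ⟨c, -, hbc⟩ := hb.exists_right_inv
  have := left_inv_eq_right_inv hab hbc
  exact ⟨b, hb, hab, this ▸ hbc⟩

/-! ### The adjoint and the residue -/

theorem IsMonicOp.adj {a : PsDO} (ha : IsMonicOp a) : IsMonicOp (adj a) := by
  constructor
  · refine (finsum_eq_single _ 0 fun k hk => ?_).trans ?_
    · rw [ha.2 _ (by omega)]
      simp
    · simp [ha.1]
  · intro n hn
    refine (finsum_congr fun k => ?_).trans finsum_zero
    rw [ha.2 _ (by omega)]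
    simp

/-- Upper negation turns `binom(-(m - k), k)` into `(-1) ^ k binom(m - 1, k)`. At `m = 1 - i` these
are the weights `binom(-i, k)` of the Leibniz rule, which is why `comp_coeff_one` holds. -/
theorem negOnePow_smul_adj_coeff {B : ℤ} {b : PsDO} (hb : VB B b) (m : ℤ) (M : ℕ) (hM : m - B < M) :
    (m.negOnePow : ℤ) • (adj b).coeff m =
      ∑ k ∈ Finset.range M, Ring.choose (m - 1) k • ((del 0) ^ k) (b.coeff (m - k)) := by
  have : (adj b).coeff m = ∑ k ∈ Finset.range M,
      (((m - (k : ℤ)).negOnePow : ℤ) * Ring.choose (-(m - (k : ℤ))) k) •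
        ((del 0) ^ k) (b.coeff (m - (k : ℤ))) := by
    refine finsum_eq_sum_of_support_subset _ fun k hk => ?_
    by_contra h
    rw [Finset.mem_coe, Finset.mem_range, not_lt] at h
    apply hk
    simp [hb (m - k) (by omega)]
  rw [this, Finset.smul_sum]
  refine Finset.sum_congr rfl fun k _ => ?_
  rw [smul_smul, Ring.choose_neg, Units.smul_def, smul_eq_mul,
    Int.negOnePow_sub, sub_add_cancel, Units.val_mul]
  congr 1
  have h1 := congrArg Units.val (Int.units_mul_self m.negOnePow)
  have h2 := congrArg Units.val (Int.units_mul_self (k : ℤ).negOnePow)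
  rw [Units.val_mul, Units.val_one] at h1 h2
  linear_combination (Ring.choose (m - 1) k) * ((k : ℤ).negOnePow : ℤ) ^ 2 * h1 +
    (Ring.choose (m - 1) k) * h2

theorem comp_coeff_one {A B : ℤ} {a b : PsDO} (ha : VB A a) (hb : VB B b) :
    (comp a b).coeff 1 = ∑ i ∈ Finset.Icc A (1 - B),
      a.coeff i * (((1 - i).negOnePow : ℤ) • (adj b).coeff (1 - i)) := by
  rw [comp_coeff_eq_sum ha hb 1 _ mem_compBox, compBox, Finset.sum_product]
  refine Finset.sum_congr rfl fun i hi => ?_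
  rw [negOnePow_smul_adj_coeff hb (1 - i) (1 - A - B + 1).toNat (by
    rw [Finset.mem_Icc] at hi; omega), Finset.mul_sum]
  refine Finset.sum_congr rfl fun k _ => ?_
  rw [mul_smul_comm, show 1 - i - 1 = -i by ring]

/-! ### The big cell of the Grassmannian -/

theorem zpow_mul_coeff (n : ℤ) (f : Lau) (k : ℤ) : (zpow n * f).coeff k = f.coeff (k + n) := by
  rw [zpow, HahnSeries.coeff_single_mul, one_mul, sub_neg_eq_add]

theorem vb_zpow (n : ℤ) : VB (-n) (zpow n) := vb_single _ _

theorem zpow_zero : zpow 0 = 1 := by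
  rw [zpow, neg_zero]
  rfl

theorem zpow_mul_zpow (m n : ℤ) : zpow m * zpow n = zpow (m + n) := by
  rw [zpow, zpow, zpow, HahnSeries.single_mul_single, mul_one, neg_add]

theorem VB.zpow_mul {N : ℤ} {f : Lau} (hf : VB N f) (n : ℤ) : VB (N - n) (zpow n * f) :=
  fun k hk => by rw [zpow_mul_coeff]; exact hf _ (by omega)

theorem isMonic_iff {n : ℕ} {f : Lau} : IsMonic n f ↔ VB (1 - n : ℤ) (f - zpow n) := by
  constructor
  · rintro ⟨h0, h⟩ k hk
    rw [HahnSeries.coeff_sub, zpow]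
    rcases eq_or_ne k (-n) with rfl | hk'
    · simp [h0]
    · rw [h k (by omega), HahnSeries.coeff_single_of_ne hk', sub_zero]
  · intro h
    have h' : ∀ k : ℤ, k < 1 - n → f.coeff k = (zpow n).coeff k := fun k hk => by
      have := h k hk
      rwa [HahnSeries.coeff_sub, sub_eq_zero] at this
    exact ⟨by rw [h' _ (by omega), zpow, HahnSeries.coeff_single_same], fun k hk => by
      rw [h' k (by omega), zpow, HahnSeries.coeff_single_of_ne hk.ne]⟩

theorem mul_smul_lau (c : ℂ) (f g : Lau) : f * (c • g) = c • (f * g) := by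
  rw [← HahnSeries.C_mul_eq_smul, ← HahnSeries.C_mul_eq_smul, mul_left_comm]

/-- In a nonzero combination of the basis the largest index `n ≥ 0` that occurs leaves a term in `z
^ n`, which a series of order at least 1 does not have. -/
theorem eq_zero_of_mem_gr {V : Submodule ℂ Lau} (hV : V ∈ Gr) {f : Lau} (hf : f ∈ V)
    (hf' : VB 1 f) : f = 0 := by
  obtain ⟨b, hb, rfl⟩ := hV
  obtain ⟨c, rfl⟩ := (Finsupp.mem_span_range_iff_exists_finsupp).mp hf
  by_contra h
  have hc : c.support.Nonempty := by
    rw [Finsupp.support_nonempty_iff]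
    rintro rfl
    simp at h
  set n := c.support.max' hc
  have hn : n ∈ c.support := Finset.max'_mem _ _
  have h1 : (c.sum fun i a => a • b i).coeff (-n : ℤ) = 0 := hf' _ (by omega)
  rw [Finsupp.sum, HahnSeries.coeff_sum, Finset.sum_eq_single n] at h1
  · rw [HahnSeries.coeff_smul, (hb n).1] at h1
    simp_all
  · intro i hi hin
    have : i ≤ n := Finset.le_max' _ _ hi
    rw [HahnSeries.coeff_smul, (hb i).2 _ (by omega), smul_zero]
  · exact fun h' => absurd hn h'

theorem exists_mem_gr_sub_vb {V : Submodule ℂ Lau} (hV : V ∈ Gr) (f : Lau) :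
    ∃ v ∈ V, VB 1 (f - v) := by
  obtain ⟨b, hb, rfl⟩ := hV
  suffices h : ∀ (n : ℕ) (f : Lau), VB (1 - n : ℤ) f →
      ∃ v ∈ Submodule.span ℂ (Set.range b), VB 1 (f - v) from
    h (1 - f.order).toNat f ((vb_order f).mono (by omega))
  intro n
  induction n with
  | zero => exact fun f hf => ⟨0, Submodule.zero_mem _, by simpa using hf⟩
  | succ n ih =>
    intro f hf
    obtain ⟨v, hv, hfv⟩ := ih (f - f.coeff (-n : ℤ) • b n) fun k hk => by
      rw [HahnSeries.coeff_sub, HahnSeries.coeff_smul]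
      rcases eq_or_ne k (-n) with rfl | hk'
      · simp [(hb n).1]
      · rw [hf k (by push_cast; omega), (hb n).2 k (by omega), smul_zero, sub_zero]
    refine ⟨f.coeff (-n : ℤ) • b n + v, Submodule.add_mem _ (Submodule.smul_mem _ _
      (Submodule.subset_span ⟨n, rfl⟩)) hv, ?_⟩
    rwa [← sub_sub]

theorem eq_of_le_of_mem_gr {V V' : Submodule ℂ Lau} (hV : V ∈ Gr) (hV' : V' ∈ Gr) (h : V ≤ V') :
    V = V' := by
  refine le_antisymm h fun f hf => ?_
  obtain ⟨v, hv, hfv⟩ := exists_mem_gr_sub_vb hV f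
  have := eq_zero_of_mem_gr hV' (V'.sub_mem hf (h hv)) hfv
  rwa [sub_eq_zero.mp this]

theorem exists_isMonic_zero_mem_gr {V : Submodule ℂ Lau} (hV : V ∈ Gr) : ∃ f ∈ V, IsMonic 0 f := by
  obtain ⟨b, hb, rfl⟩ := hV
  exact ⟨b 0, Submodule.subset_span ⟨0, rfl⟩, hb 0⟩

theorem eq_of_isMonic_zero_mem_gr {V : Submodule ℂ Lau} (hV : V ∈ Gr) {f g : Lau} (hf : f ∈ V)
    (hg : g ∈ V) (hf' : IsMonic 0 f) (hg' : IsMonic 0 g) : f = g := by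
  rw [← sub_eq_zero]
  refine eq_zero_of_mem_gr hV (V.sub_mem hf hg) ?_
  have := (isMonic_iff.mp hf').sub (isMonic_iff.mp hg')
  rw [sub_sub_sub_cancel_right] at this
  exact this

/-- The orthogonal complement for the residue pairing. -/
def perp (V : Submodule ℂ Lau) : Submodule ℂ Lau where
  carrier := {g | ∀ f ∈ V, (f * g).coeff 1 = 0}
  zero_mem' f _ := by simp
  add_mem' hg hg' f hf := by rw [mul_add, HahnSeries.coeff_add, hg f hf, hg' f hf, add_zero]
  smul_mem' c g hg f hf := by
    rw [mul_smul_lau, HahnSeries.coeff_smul, hg f hf, smul_zero]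

/-- If `g` starts at `z ^ (-N - 1)`, its residue against `z ^ N + …` is its leading coefficient;
thus the coefficients vanish one after another. -/
theorem eq_zero_of_mem_perp {V : Submodule ℂ Lau} (hV : V ∈ Gr) {g : Lau} (hg : g ∈ perp V)
    (hg' : VB 1 g) : g = 0 := by
  obtain ⟨b, hb, rfl⟩ := hV
  refine eq_zero_of_vb fun N => VB.mono (?_ : VB (1 + N : ℤ) g) (by omega)
  induction N with
  | zero => simpa using hg'
  | succ N ih =>
    intro k hk
    rcases lt_or_eq_of_le (show k ≤ 1 + N by push_cast at hk; omega) with hlt | rfl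
    · exact ih k hlt
    · have h := hg (b N) (Submodule.subset_span ⟨N, rfl⟩)
      rw [coeff_mul_eq_sum (hb N).2 ih 1 {(-N : ℤ)} (fun i h1 h2 => by
        rw [Finset.mem_singleton]; omega), Finset.sum_singleton, (hb N).1, one_mul,
        sub_neg_eq_add] at h
      exact h

theorem eq_perp_of_le {V V' : Submodule ℂ Lau} (hV : V ∈ Gr) (hV' : V' ∈ Gr) (h : V' ≤ perp V) :
    V' = perp V := by
  refine le_antisymm h fun f hf => ?_
  obtain ⟨v, hv, hfv⟩ := exists_mem_gr_sub_vb hV' f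
  have := eq_zero_of_mem_perp hV ((perp V).sub_mem hf (h hv)) hfv
  rwa [sub_eq_zero.mp this]

theorem stable_perp {T T' : Module.End ℂ Lau} (h : ∀ f g, (T f * g).coeff 1 = (f * T' g).coeff 1)
    {V : Submodule ℂ Lau} (hV : Stable T V) : Stable T' (perp V) := by
  rintro _ ⟨g, hg, rfl⟩ f hf
  rw [← h]
  exact hg _ (hV ⟨f, hf, rfl⟩)

/-! ### The operators `A_p^±` -/

theorem mulZ_apply (n : ℤ) (f : Lau) : mulZ n f = zpow n * f := rfl

theorem euler_coeff (f : Lau) (n : ℤ) : (euler f).coeff n = -(n : ℂ) * f.coeff n := rfl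

theorem opA_apply (p : ℕ) (ε : ℤˣ) (f : Lau) : opA p ε f = zpow 1 * f +
    (((ε : ℤ) : ℂ) / (p : ℂ)) • (zpow (-p) * (euler f - (((p : ℂ) - 1) / 2) • f)) := rfl

theorem opA_coeff (p : ℕ) (ε : ℤˣ) (f : Lau) (n : ℤ) : (opA p ε f).coeff n = f.coeff (n + 1) +
    ((ε : ℤ) : ℂ) / p * ((-((n : ℂ) - p) - ((p : ℂ) - 1) / 2) * f.coeff (n - p)) := by
  rw [opA_apply, HahnSeries.coeff_add, HahnSeries.coeff_smul, zpow_mul_coeff, zpow_mul_coeff,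
    HahnSeries.coeff_sub, HahnSeries.coeff_smul, euler_coeff, ← sub_eq_add_neg]
  push_cast
  simp only [smul_eq_mul]
  ring

/-- The commutator `[A, z ^ p] = ε`: only the derivative term contributes, and `z ∂_z` gives `p` on
`z ^ p`. -/
theorem opA_mulZ (p : ℕ) (hp : 1 ≤ p) (ε : ℤˣ) (f : Lau) :
    opA p ε (mulZ p f) = mulZ p (opA p ε f) + ((ε : ℤ) : ℂ) • f := by
  have hp' : (p : ℂ) ≠ 0 := Nat.cast_ne_zero.mpr (by omega)
  ext1; funext n
  rw [HahnSeries.coeff_add, HahnSeries.coeff_smul, mulZ_apply, mulZ_apply, zpow_mul_coeff,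
    opA_coeff, opA_coeff, zpow_mul_coeff, zpow_mul_coeff, show n + 1 + (p : ℤ) = n + p + 1 by ring,
    sub_add_cancel, add_sub_cancel_right]
  push_cast
  simp only [smul_eq_mul]
  field_simp
  ring

/-- The first correction to `A ^ q = z ^ q + …`. -/
theorem opA_pow_sub (p : ℕ) (ε : ℤˣ) {n : ℤ} {f : Lau} (hf : VB n f) (q : ℕ) :
    VB (n - q + p + 1) ((opA p ε ^ q) f - zpow q * f) ∧
    ((opA p ε ^ q) f - zpow q * f).coeff (n - q + p + 1) =
      ((ε : ℤ) : ℂ) / p * ((q * (-n - ((p : ℂ) - 1) / 2) + q * ((q : ℂ) - 1) / 2) * f.coeff n) := by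
  -- To first order one of the `q` factors contributes its derivative term, which acts on degree `-n
  -- + j` for `j = 0, …, q - 1`; the constant is the sum of `-n + j - (p - 1) / 2` over `j`.
  induction q with
  | zero => simp [zpow_zero, vb_zero]
  | succ q ih =>
    obtain ⟨h1, h2⟩ := ih
    have key : ∀ j : ℤ, j ≤ n - (q + 1 : ℕ) + p + 1 →
        ((opA p ε ^ (q + 1)) f - zpow (q + 1 : ℕ) * f).coeff j =
        ((opA p ε ^ q) f - zpow q * f).coeff (j + 1) + ((ε : ℤ) : ℂ) / p *
          ((-((j : ℂ) - p) - ((p : ℂ) - 1) / 2) * f.coeff (j - p + q)) := by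
      intro j hj
      have h3 := h1 (j - p) (by push_cast at hj; omega)
      rw [HahnSeries.coeff_sub, zpow_mul_coeff, sub_eq_zero] at h3
      rw [pow_succ', Module.End.mul_apply, HahnSeries.coeff_sub, opA_coeff, HahnSeries.coeff_sub,
        h3, zpow_mul_coeff, zpow_mul_coeff,
        show j + ((q + 1 : ℕ) : ℤ) = j + 1 + q by push_cast; ring]
      ring
    constructor
    · intro j hj
      rw [key j hj.le, h1 _ (by push_cast at hj; omega), hf _ (by push_cast at hj; omega)]
      simp
    · rw [key _ le_rfl, show n - ((q + 1 : ℕ) : ℤ) + p + 1 + 1 = n - q + p + 1 by push_cast; ring,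
        h2, show n - ((q + 1 : ℕ) : ℤ) + p + 1 - p + q = n by push_cast; ring]
      push_cast
      ring

theorem opA_pow_isMonic (p : ℕ) (ε : ℤˣ) {f : Lau} (hf : IsMonic 0 f) (q : ℕ) :
    IsMonic q ((opA p ε ^ q) f) := by
  rw [isMonic_iff]
  have h := ((opA_pow_sub p ε hf.2 q).1).mono (by simp; omega : (1 - q : ℤ) ≤ _)
  have h' := (isMonic_iff.mp hf).zpow_mul q
  rw [mul_sub, zpow_mul_zpow] at h'
  have := h.add (by simpa using h' : VB (1 - q : ℤ) (zpow q * f - zpow q))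
  rwa [sub_add_sub_cancel] at this

/-- `A ^ p - z ^ p` lowers the degree in `z` and multiplies leading terms like `±∂_z`. -/
theorem opA_pow_self_sub (p : ℕ) (hp : 1 ≤ p) (ε : ℤˣ) {n : ℤ} {f : Lau} (hf : VB n f) :
    VB (n + 1) ((opA p ε ^ p) f - zpow p * f) ∧
    ((opA p ε ^ p) f - zpow p * f).coeff (n + 1) = -((ε : ℤ) : ℂ) * n * f.coeff n := by
  have hp' : (p : ℂ) ≠ 0 := Nat.cast_ne_zero.mpr (by omega)
  have h := opA_pow_sub p ε hf p
  rw [sub_add_cancel] at h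
  -- For `q = p` the shift `(p - 1) / 2` cancels the sum of the `j` exactly, leaving `-p n`.
  refine ⟨h.1, h.2.trans ?_⟩
  field_simp
  ring

theorem sign_mul_self (ε : ℤˣ) : ((ε : ℤ) : ℂ) * ((ε : ℤ) : ℂ) = 1 := by
  have := congrArg Units.val (Int.units_mul_self ε)
  rw [Units.val_mul, Units.val_one] at this
  exact_mod_cast this

theorem eq_zero_of_opA_pow (p : ℕ) (hp : 1 ≤ p) (ε : ℤˣ) {f : Lau} (hf : VB 1 f)
    (h : (opA p ε ^ p) f = zpow p * f) : f = 0 := by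
  refine eq_zero_of_vb fun N => VB.mono (?_ : VB (1 + N : ℤ) f) (by omega)
  induction N with
  | zero => simpa using hf
  | succ N ih =>
    have h1 := (opA_pow_self_sub p hp ε ih).2
    rw [sub_eq_zero.mpr h, HahnSeries.coeff_zero] at h1
    have h2 : f.coeff (1 + N) = 0 := by
      have h3 : ((1 + N : ℤ) : ℂ) ≠ 0 := by exact_mod_cast (by omega : (1 + N : ℤ) ≠ 0)
      have h4 : -((ε : ℤ) : ℂ) ≠ 0 := neg_ne_zero.mpr (left_ne_zero_of_mul_eq_one (sign_mul_self ε))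
      exact (mul_eq_zero.mp h1.symm).resolve_left (mul_ne_zero h4 h3)
    intro k hk
    rcases lt_or_eq_of_le (show k ≤ 1 + N by push_cast at hk; omega) with hlt | rfl
    · exact ih k hlt
    · exact h2

theorem existsUnique_opA_pow (p : ℕ) (hp : 1 ≤ p) (ε : ℤˣ) :
    ∃! f : Lau, IsMonic 0 f ∧ (opA p ε ^ p) f = zpow p * f := by
  let T : Lau →+ Lau := (opA p ε ^ p - mulZ p : Module.End ℂ Lau).toAddMonoidHom
  have hT : ∀ f, T f = (opA p ε ^ p) f - zpow p * f := fun f => rfl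
  obtain ⟨f, hf, hTf⟩ := exists_triangular_solution T 1
    (fun n a ha => (opA_pow_self_sub p hp ε ha).1)
    (fun n hn r => by
      have hn' : (n : ℂ) ≠ 0 := by exact_mod_cast (by omega : n ≠ 0)
      refine ⟨-((ε : ℤ) : ℂ) / n * r, ?_⟩
      rw [hT, (opA_pow_self_sub p hp ε (vb_single n _)).2, HahnSeries.coeff_single_same]
      field_simp
      linear_combination r * sign_mul_self ε) 0 (zpow 0) (by
      -- The recursion can start from `1`: the diagonal factor `-ε n` is zero at `n = 0`, so the
      -- error has order at least 2.
      have h := opA_pow_self_sub p hp ε (vb_zpow 0)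
      rw [sub_zero, hT]
      intro k hk
      rcases lt_or_eq_of_le (show k ≤ -0 + 1 by omega) with hlt | rfl
      · exact h.1 k hlt
      · rw [h.2]; simp)
  refine ⟨f, ⟨isMonic_iff.mpr (by simpa using hf), sub_eq_zero.mp hTf⟩, fun g hg => ?_⟩
  rw [← sub_eq_zero]
  refine eq_zero_of_opA_pow p hp ε ?_ ?_
  · have := (isMonic_iff.mp hg.1).sub hf
    simpa using this
  · rw [map_sub, mul_sub, hg.2, sub_eq_zero.mp hTf, mulZ_apply]

/-! ### Planes stable under `A` and `z ^ p`. -/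

/-- The span of the `A ^ i f`. -/
def opASpan (p : ℕ) (ε : ℤˣ) (f : Lau) : Submodule ℂ Lau :=
  Submodule.span ℂ (Set.range fun i : ℕ => (opA p ε ^ i) f)

theorem opASpan_mem_gr (p : ℕ) (ε : ℤˣ) {f : Lau} (hf : IsMonic 0 f) : opASpan p ε f ∈ Gr :=
  ⟨_, opA_pow_isMonic p ε hf, rfl⟩

theorem opA_pow_mem {p : ℕ} {ε : ℤˣ} {V : Submodule ℂ Lau} (hV : Stable (opA p ε) V) {f : Lau}
    (hf : f ∈ V) (i : ℕ) : (opA p ε ^ i) f ∈ V := by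
  induction i with
  | zero => simpa using hf
  | succ i ih =>
    rw [pow_succ', Module.End.mul_apply]
    exact hV ⟨_, ih, rfl⟩

theorem stable_opASpan (p : ℕ) (ε : ℤˣ) (f : Lau) : Stable (opA p ε) (opASpan p ε f) := by
  rw [Stable, opASpan, Submodule.map_span_le]
  rintro _ ⟨i, rfl⟩
  refine Submodule.subset_span ⟨i + 1, ?_⟩
  simp only [pow_succ', Module.End.mul_apply]

theorem stable_mulZ_opASpan (p : ℕ) (hp : 1 ≤ p) (ε : ℤˣ) {f : Lau}
    (hf : (opA p ε ^ p) f = zpow p * f) : Stable (mulZ p) (opASpan p ε f) := by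
  have h : ∀ i, (opA p ε ^ i) f ∈ opASpan p ε f := fun i => Submodule.subset_span ⟨i, rfl⟩
  rw [Stable]
  nth_rw 1 [opASpan]
  rw [Submodule.map_span_le]
  rintro _ ⟨i, rfl⟩
  simp only
  induction i with
  | zero =>
    rw [pow_zero, Module.End.one_apply, mulZ_apply, ← hf]
    exact h p
  | succ i ih =>
    have h1 := opA_mulZ p hp ε ((opA p ε ^ i) f)
    rw [pow_succ', Module.End.mul_apply, ← sub_eq_iff_eq_add.mpr h1]
    exact Submodule.sub_mem _ (stable_opASpan p ε f ⟨_, ih, rfl⟩) (Submodule.smul_mem _ _ (h i))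

theorem gr_stable_iff (p : ℕ) (hp : 1 ≤ p) (ε : ℤˣ) {f : Lau} (hf : IsMonic 0 f)
    (hf' : (opA p ε ^ p) f = zpow p * f) (V : Submodule ℂ Lau) :
    (V ∈ Gr ∧ Stable (mulZ p) V ∧ Stable (opA p ε) V) ↔ V = opASpan p ε f := by
  constructor
  · rintro ⟨hV, hz, hA⟩
    obtain ⟨g, hg, hg'⟩ := exists_isMonic_zero_mem_gr hV
    have h : (opA p ε ^ p) g = zpow p * g := by
      rw [← sub_eq_zero]
      exact eq_zero_of_mem_gr hV (V.sub_mem (opA_pow_mem hA hg p) (hz ⟨g, hg, rfl⟩))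
        (opA_pow_self_sub p hp ε hg'.2).1
    obtain rfl := (existsUnique_opA_pow p hp ε).unique ⟨hf, hf'⟩ ⟨hg', h⟩
    refine (eq_of_le_of_mem_gr (opASpan_mem_gr p ε hf) hV (Submodule.span_le.mpr ?_)).symm
    rintro _ ⟨i, rfl⟩
    exact opA_pow_mem hA hg i
  · rintro rfl
    exact ⟨opASpan_mem_gr p ε hf, stable_mulZ_opASpan p hp ε hf', stable_opASpan p ε f⟩

/-! ### Transposes for the residue pairing. -/

theorem euler_mul (f g : Lau) : euler (f * g) = euler f * g + f * euler g := by
  have he : ∀ h : Lau, VB h.order (euler h) := fun h n hn => by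
    rw [euler_coeff, vb_order h n hn, mul_zero]
  ext1; funext n
  have hs : ∀ i, f.order ≤ i → g.order ≤ n - i → i ∈ Finset.Icc f.order (n - g.order) :=
    fun i h1 h2 => Finset.mem_Icc.mpr (by omega)
  rw [HahnSeries.coeff_add, euler_coeff, coeff_mul_eq_sum (vb_order f) (vb_order g) n _ hs,
    coeff_mul_eq_sum (he f) (vb_order g) n _ hs, coeff_mul_eq_sum (vb_order f) (he g) n _ hs,
    Finset.mul_sum, ← Finset.sum_add_distrib]
  refine Finset.sum_congr rfl fun i _ => ?_
  rw [euler_coeff, euler_coeff]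
  push_cast
  ring

theorem euler_zpow (n : ℤ) : euler (zpow n) = (n : ℂ) • zpow n := by
  ext1; funext k
  rw [euler_coeff, HahnSeries.coeff_smul, zpow]
  rcases eq_or_ne k (-n) with rfl | hk
  · simp
  · simp [HahnSeries.coeff_single_of_ne hk]

/-- The residue pairing makes `A_p^{-ε}` the transpose of `A_p^ε`. -/
theorem opA_transpose (p : ℕ) (ε : ℤˣ) (f g : Lau) :
    (opA p ε f * g).coeff 1 = (f * opA p (-ε) g).coeff 1 := by
  have h1 : ∀ h : Lau, (euler h).coeff 0 = 0 := fun h => by simp [euler_coeff]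
  have h2 := h1 (zpow (1 - p) * f * g)
  -- The two sides differ by a multiple of `∂_z (z ^ (1 - p) f g)`, which has no residue; the two
  -- shifts `(p - 1) / 2` add up to the factor needed for this exact derivative.
  have h3 : euler (zpow (1 - p) * f * g) = zpow 1 * (zpow (-p) * ((1 - (p : ℂ)) • (f * g) +
      euler f * g + f * euler g)) := by
    rw [euler_mul, euler_mul, euler_zpow, show (1 - p : ℤ) = 1 + -p by ring, ← zpow_mul_zpow]
    rw [show ((1 + -p : ℤ) : ℂ) = 1 - p by push_cast; ring]
    simp only [← HahnSeries.C_mul_eq_smul]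
    generalize (HahnSeries.C (1 - (p : ℂ)) : Lau) = x
    ring
  rw [h3, zpow_mul_coeff, zero_add] at h2
  have h4 : opA p ε f * g = f * opA p (-ε) g + (((ε : ℤ) : ℂ) / p) •
      (zpow (-p) * ((1 - (p : ℂ)) • (f * g) + euler f * g + f * euler g)) := by
    have h5 : (1 - (p : ℂ)) = - (((p : ℂ) - 1) / 2 + ((p : ℂ) - 1) / 2) := by ring
    rw [opA_apply, opA_apply, h5]
    simp only [Units.val_neg, Int.cast_neg, neg_div, ← HahnSeries.C_mul_eq_smul, map_neg, map_add]
    generalize (HahnSeries.C (((ε : ℤ) : ℂ) / p) : Lau) = x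
    generalize (HahnSeries.C (((p : ℂ) - 1) / 2) : Lau) = y
    ring
  rw [h4, HahnSeries.coeff_add, HahnSeries.coeff_smul, h2, smul_zero, add_zero]

theorem mulZ_transpose (n : ℤ) (f g : Lau) : (mulZ n f * g).coeff 1 = (f * mulZ n g).coeff 1 := by
  rw [mulZ_apply, mulZ_apply, mul_right_comm, mul_comm, mul_left_comm]

/-! ### Series with coefficients in a point of the Grassmannian -/

theorem mul_natCast_lau (f : Lau) (n : ℕ) : f * (n : Lau) = (n : ℂ) • f := by
  rw [← HahnSeries.C_mul_eq_smul, map_natCast, mul_comm]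

theorem coeff_mul_C_lau (c : ℂ) (f : Lau) (n : ℤ) :
    (HahnSeries.C c * f : Lau).coeff n = c * f.coeff n := by
  rw [HahnSeries.C_mul_eq_smul, HahnSeries.coeff_smul, smul_eq_mul]

section Transversal

variable {σ : Type*} [DecidableEq σ]

theorem degree_fst_lt {m : σ →₀ ℕ} {q : (σ →₀ ℕ) × (σ →₀ ℕ)}
    (hq : q ∈ Finset.HasAntidiagonal.antidiagonal m) (hne : q ≠ (m, 0)) :
    q.1.degree < m.degree := by
  rw [Finset.HasAntidiagonal.mem_antidiagonal] at hq
  have h2 : q.2 ≠ 0 := fun h => hne (Prod.ext (by rw [← hq, h, add_zero]) h)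
  have h3 : q.2.degree ≠ 0 := fun h => h2 ((Finsupp.degree_eq_zero_iff _).mp h)
  rw [← hq, map_add]
  omega

theorem eq_zero_of_mul_mem_gr {V : Submodule ℂ Lau} (hV : V ∈ Gr) {v E : MvPowerSeries σ Lau}
    (hE : MvPowerSeries.coeff 0 E = 1) (hv : ∀ m, VB 1 (MvPowerSeries.coeff m v))
    (h : ∀ m, MvPowerSeries.coeff m (v * E) ∈ V) : v = 0 := by
  suffices h' : ∀ (d : ℕ) (m : σ →₀ ℕ), m.degree = d → MvPowerSeries.coeff m v = 0 by
    ext1 m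
    exact h' _ m rfl
  intro d
  induction d using Nat.strong_induction_on with
  | _ d ih =>
    rintro m rfl
    refine eq_zero_of_mem_gr hV ?_ (hv m)
    have h1 := h m
    rw [MvPowerSeries.coeff_mul, Finset.sum_eq_single (m, 0)] at h1
    · rwa [hE, mul_one] at h1
    · intro q hq hne
      rw [ih _ (degree_fst_lt hq hne) _ rfl, zero_mul]
    · intro h2
      simp at h2

theorem exists_mul_mem_gr {V : Submodule ℂ Lau} (hV : V ∈ Gr) {E : MvPowerSeries σ Lau}
    (hE : MvPowerSeries.coeff 0 E = 1) : ∃ w : MvPowerSeries σ Lau,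
      (∀ m, VB 1 (MvPowerSeries.coeff m (w - 1))) ∧ ∀ m, MvPowerSeries.coeff m (w * E) ∈ V := by
  choose π hπ hπ' using exists_mem_gr_sub_vb hV
  -- Recursion on the total degree: `G` collects the part of the coefficient of `(1 + v) E` already
  -- fixed by lower degrees, and `v` at `m` moves it into `V` by a correction of order at least 1.
  -- The truncation `π` need not be linear.
  let G : (m : σ →₀ ℕ) → ((n : σ →₀ ℕ) → n.degree < m.degree → Lau) → Lau := fun m r =>
    MvPowerSeries.coeff m E + ∑ q ∈ Finset.HasAntidiagonal.antidiagonal m,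
      if h : q.1.degree < m.degree then r q.1 h * MvPowerSeries.coeff q.2 E else 0
  let v : MvPowerSeries σ Lau :=
    (measure fun m : σ →₀ ℕ => m.degree).wf.fix fun m r => π (G m r) - G m r
  have hv : ∀ m, MvPowerSeries.coeff m v = π (G m fun n _ => v n) - G m fun n _ => v n :=
    fun m => WellFounded.fix_eq _ _ m
  refine ⟨1 + v, fun m => ?_, fun m => ?_⟩
  · rw [add_sub_cancel_left, hv, ← neg_sub]
    exact (hπ' _).neg
  · have h : MvPowerSeries.coeff m (v * E) = MvPowerSeries.coeff m v +
        ∑ q ∈ Finset.HasAntidiagonal.antidiagonal m,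
          if h : q.1.degree < m.degree then v q.1 * MvPowerSeries.coeff q.2 E else 0 := by
      rw [MvPowerSeries.coeff_mul, ← Finset.add_sum_erase _ _ (show (m, 0) ∈
        Finset.HasAntidiagonal.antidiagonal m by simp), hE, mul_one,
        ← Finset.add_sum_erase _ (fun q : (σ →₀ ℕ) × (σ →₀ ℕ) =>
          if h : q.1.degree < m.degree then v q.1 * MvPowerSeries.coeff q.2 E else 0)
        (show (m, 0) ∈ Finset.HasAntidiagonal.antidiagonal m by simp)]
      simp only [lt_irrefl, dite_false, zero_add]
      congr 1
      refine Finset.sum_congr rfl fun q hq => ?_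
      rw [Finset.mem_erase] at hq
      rw [dif_pos (degree_fst_lt hq.2 hq.1)]
      rfl
    rw [add_mul, one_mul, map_add, h, hv, add_left_comm]
    simp only [G, sub_add_cancel]
    exact hπ _

end Transversal

/-! ### The exponential -/

theorem expKP_coeff (ε : ℤˣ) (m : ℕ →₀ ℕ) : MvPowerSeries.coeff m (expKP ε) = m.prod fun i k =>
    ((k.factorial : ℂ)⁻¹) • (((ε : ℤ) : ℂ) • zpow (if i = 0 then 1 else (i : ℤ))) ^ k := rfl

theorem expKP_coeff_zero (ε : ℤˣ) : MvPowerSeries.coeff 0 (expKP ε) = 1 := by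
  rw [expKP_coeff, Finsupp.prod_zero_index]

theorem zpow_pow (n : ℤ) (k : ℕ) : zpow n ^ k = zpow (k * n) := by
  induction k with
  | zero => simp [zpow_zero]
  | succ k ih => rw [pow_succ, ih, zpow_mul_zpow]; push_cast; ring_nf

theorem expKP_coeff_single (ε : ℤˣ) (k : ℕ) : MvPowerSeries.coeff (Finsupp.single 0 k) (expKP ε) =
    (((ε : ℤ) : ℂ) ^ k * (k.factorial : ℂ)⁻¹) • zpow k := by
  rw [expKP_coeff, Finsupp.prod_single_index (by simp), if_pos rfl]
  simp only [← HahnSeries.C_mul_eq_smul, mul_pow, zpow_pow, mul_one, map_mul, map_pow]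
  ring

theorem pderiv_expKP (ε : ℤˣ) (i : ℕ) : MvPowerSeries.pderiv Lau i (expKP ε) =
    MvPowerSeries.C (((ε : ℤ) : ℂ) • zpow (if i = 0 then 1 else (i : ℤ))) * expKP ε := by
  ext1 m
  rw [MvPowerSeries.coeff_pderiv, MvPowerSeries.coeff_C_mul, expKP_coeff, expKP_coeff]
  set h : ℕ → ℕ → Lau := fun i k =>
    ((k.factorial : ℂ)⁻¹) • (((ε : ℤ) : ℂ) • zpow (if i = 0 then 1 else (i : ℤ))) ^ k with hh
  have h0 : ∀ i, h i 0 = 1 := fun i => by simp [hh]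
  rw [← Finsupp.mul_prod_erase' (m + Finsupp.single i 1) i h h0,
    ← Finsupp.mul_prod_erase' m i h h0, Finsupp.erase_add,
    Finsupp.erase_single, add_zero, Finsupp.add_apply, Finsupp.single_eq_same]
  have h1 : h i (m i + 1) * ((m i : Lau) + 1) =
      (((ε : ℤ) : ℂ) • zpow (if i = 0 then 1 else (i : ℤ))) * h i (m i) := by
    have h2 : (((m i + 1).factorial : ℂ)⁻¹) * (m i + 1 : ℕ) = ((m i).factorial : ℂ)⁻¹ := by
      rw [Nat.factorial_succ]
      have : ((m i + 1 : ℕ) : ℂ) ≠ 0 := Nat.cast_ne_zero.mpr (Nat.succ_ne_zero _)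
      push_cast at this ⊢
      field_simp
    simp only [hh, ← h2]
    generalize (((ε : ℤ) : ℂ) • zpow (if i = 0 then 1 else (i : ℤ)) : Lau) = x
    simp only [← HahnSeries.C_mul_eq_smul, map_mul, map_natCast]
    push_cast
    ring
  linear_combination (m.erase i).prod h * h1

/-- All partial derivatives of the product vanish and its constant term is 1; torsion-freeness makes
this decisive. -/
theorem expKP_mul_expKP_neg : expKP 1 * expKP (-1) = 1 := by
  have : IsAddTorsionFree Lau := ⟨fun n hn f g h => by
    ext k
    have := congrArg (fun f : Lau => f.coeff k) h
    simp only [nsmul_eq_mul, mul_comm (n : Lau), mul_natCast_lau, HahnSeries.coeff_smul] at this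
    simpa [hn] using this⟩
  refine MvPowerSeries.pderiv.ext (fun i => ?_) ?_
  · rw [Derivation.leibniz, pderiv_expKP, pderiv_expKP, MvPowerSeries.pderiv_one]
    simp only [Units.val_neg, Units.val_one, Int.cast_neg, Int.cast_one, smul_eq_mul,
      ← HahnSeries.C_mul_eq_smul, map_neg, map_one, neg_mul, one_mul]
    ring
  · rw [map_mul, ← MvPowerSeries.coeff_zero_eq_constantCoeff_apply,
      ← MvPowerSeries.coeff_zero_eq_constantCoeff_apply, expKP_coeff_zero, expKP_coeff_zero]
    simp

/-! ### Symbols -/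

theorem symbol_coeff (ε : ℤˣ) (a : PsDO) (m : ℕ →₀ ℕ) (n : ℤ) :
    (MvPowerSeries.coeff m (symbol ε a)).coeff n =
      (((ε ^ n : ℤˣ) : ℤ) : ℂ) * MvPowerSeries.coeff m (a.coeff n) := rfl

theorem symbol_one_coeff (a : PsDO) (m : ℕ →₀ ℕ) (n : ℤ) :
    (MvPowerSeries.coeff m (symbol 1 a)).coeff n = MvPowerSeries.coeff m (a.coeff n) := by
  rw [symbol_coeff]
  simp

theorem symbol_one_injective : Function.Injective (symbol 1) := by
  intro a b h
  ext n m
  rw [← symbol_one_coeff, h, symbol_one_coeff]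

theorem symbol_one_add (a b : PsDO) : symbol 1 (a + b) = symbol 1 a + symbol 1 b := by
  ext m n
  rw [map_add, HahnSeries.coeff_add, symbol_one_coeff, symbol_one_coeff, symbol_one_coeff,
    HahnSeries.coeff_add, map_add]

theorem VB.symbol {N : ℤ} {a : PsDO} (ha : VB N a) (ε : ℤˣ) (m : ℕ →₀ ℕ) :
    VB N (MvPowerSeries.coeff m (symbol ε a)) := fun n hn => by
  rw [symbol_coeff, ha n hn, map_zero, mul_zero]

theorem IsMonicOp.symbol {a : PsDO} (ha : IsMonicOp a) (ε : ℤˣ) (m : ℕ →₀ ℕ) :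
    VB 1 (MvPowerSeries.coeff m (symbol ε a - 1)) := by
  intro n hn
  rw [map_sub, HahnSeries.coeff_sub, symbol_coeff, sub_eq_zero, MvPowerSeries.coeff_one]
  rcases eq_or_ne n 0 with rfl | hn'
  · rw [ha.1, MvPowerSeries.coeff_one]
    split_ifs <;> simp
  · rw [ha.2 n (by omega), map_zero, mul_zero]
    split_ifs
    · rw [HahnSeries.coeff_one, if_neg hn']
    · simp

theorem pderiv_symbol (ε : ℤˣ) (i : ℕ) (a : PsDO) :
    MvPowerSeries.pderiv Lau i (symbol ε a) = symbol ε (delCoeff i a) := by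
  ext m n
  have h : (delCoeff i a).coeff n = MvPowerSeries.pderiv ℂ i (a.coeff n) := rfl
  rw [MvPowerSeries.coeff_pderiv, symbol_coeff, h, MvPowerSeries.coeff_pderiv, ← Nat.cast_succ,
    mul_natCast_lau, HahnSeries.coeff_smul, symbol_coeff, smul_eq_mul]
  push_cast
  ring

theorem symbol_comp_Dpow (a : PsDO) (i : ℤ) :
    symbol 1 (comp a (Dpow i)) = MvPowerSeries.C (zpow i) * symbol 1 a := by
  ext m n
  rw [symbol_one_coeff, comp_Dpow_right_coeff, MvPowerSeries.coeff_C_mul, zpow_mul_coeff,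
    symbol_one_coeff]

theorem actExp_add (a b : PsDO) : actExp 1 (a + b) = actExp 1 a + actExp 1 b := by
  rw [actExp, symbol_one_add, add_mul, actExp, actExp]

/-- The derivative falls on the coefficients or on the exponential, where it produces `z ^ i`, that
is `D ^ i` composed on the right. The variable `x` carries `z`, like `t_1`. -/
theorem pderiv_actExp (i : ℕ) (a : PsDO) : MvPowerSeries.pderiv Lau i (actExp 1 a) =
    actExp 1 (delCoeff i a + comp a (Dpow (if i = 0 then 1 else (i : ℤ)))) := by
  rw [actExp, Derivation.leibniz, pderiv_expKP, pderiv_symbol, actExp, symbol_one_add,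
    symbol_comp_Dpow]
  simp only [Units.val_one, Int.cast_one, one_smul, smul_eq_mul]
  ring

theorem Dpow_one_comp (a : PsDO) : comp (Dpow 1) a = delCoeff 0 a + comp a (Dpow 1) := by
  ext1; funext n
  rw [Dpow_one_comp_coeff, HahnSeries.coeff_add, comp_Dpow_right_coeff, add_comm]
  rfl

theorem actExp_Dpow_comp (a : PsDO) (k : ℕ) :
    actExp 1 (comp (Dpow k) a) = (MvPowerSeries.pderiv Lau 0)^[k] (actExp 1 a) := by
  induction k with
  | zero => simp [Dpow_zero_comp]
  | succ k ih =>
    rw [Function.iterate_succ_apply', ← ih, pderiv_actExp, if_pos rfl, ← Dpow_one_comp,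
      ← comp_assoc, Dpow_comp_Dpow]
    push_cast
    rw [add_comm]

theorem actExp_single_comp (a : PsDO) (k : ℕ) (f : Fun) :
    actExp 1 (comp (HahnSeries.single (-k : ℤ) f) a) =
      MvPowerSeries.map (HahnSeries.C : ℂ →+* Lau) f *
        (MvPowerSeries.pderiv Lau 0)^[k] (actExp 1 a) := by
  rw [← actExp_Dpow_comp, actExp, actExp, ← mul_assoc]
  congr 1
  ext m n
  rw [symbol_one_coeff, comp_single_left_coeff', neg_neg, MvPowerSeries.coeff_mul,
    MvPowerSeries.coeff_mul, HahnSeries.coeff_sum]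
  refine Finset.sum_congr rfl fun q _ => ?_
  rw [MvPowerSeries.coeff_map, coeff_mul_C_lau, symbol_one_coeff]

/-! ### Planes -/

theorem constantCoeff_dX_iterate (F : PowerSeries Lau) (i : ℕ) :
    PowerSeries.constantCoeff (dX^[i] F) = (i.factorial : ℂ) • PowerSeries.coeff i F := by
  have h : ∀ k, PowerSeries.coeff k (dX^[i] F) =
      PowerSeries.coeff (k + i) F * (((k + 1).ascFactorial i : ℕ) : Lau) := by
    induction i with
    | zero => simp
    | succ i ih =>
      intro k
      have h1 : (k + 1) * (k + 1 + 1).ascFactorial i = (k + 1).ascFactorial (i + 1) :=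
        Nat.succ_ascFactorial (k + 1) i
      rw [Function.iterate_succ_apply', dX, PowerSeries.coeff_derivative, ih, ← h1,
        show k + 1 + i = k + (i + 1) by ring]
      push_cast
      ring
  rw [← PowerSeries.coeff_zero_eq_constantCoeff_apply, h, zero_add, zero_add, mul_natCast_lau,
    Nat.one_ascFactorial]

theorem atTimeZero_coeff (F : MvPowerSeries ℕ Lau) (n : ℕ) :
    PowerSeries.coeff n (atTimeZero F) = MvPowerSeries.coeff (Finsupp.single 0 n) F :=
  PowerSeries.coeff_mk _ _

theorem atTimeZero_mul (F G : MvPowerSeries ℕ Lau) :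
    atTimeZero (F * G) = atTimeZero F * atTimeZero G := by
  ext1 n
  rw [atTimeZero_coeff, MvPowerSeries.coeff_mul, PowerSeries.coeff_mul,
    Finsupp.antidiagonal_single, Finset.sum_map]
  exact Finset.sum_congr rfl fun q _ => by rw [atTimeZero_coeff, atTimeZero_coeff]; rfl

/-- The span of the derivatives at `x = 0` of a power series. -/
def planeOf (F : PowerSeries Lau) : Submodule ℂ Lau :=
  Submodule.span ℂ (Set.range fun i : ℕ => PowerSeries.constantCoeff (dX^[i] F))

theorem planeOf_le_iff (F : PowerSeries Lau) (V : Submodule ℂ Lau) :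
    planeOf F ≤ V ↔ ∀ n, PowerSeries.coeff n F ∈ V := by
  rw [planeOf, Submodule.span_le, Set.range_subset_iff]
  refine forall_congr' fun n => ?_
  rw [constantCoeff_dX_iterate]
  have h : (n.factorial : ℂ) ≠ 0 := Nat.cast_ne_zero.mpr (Nat.factorial_ne_zero n)
  exact Submodule.smul_mem_iff V h

theorem planeOf_mem_gr (ε : ℤˣ) {w : MvPowerSeries ℕ Lau}
    (hw : ∀ m, VB 1 (MvPowerSeries.coeff m (w - 1))) : planeOf (atTimeZero (w * expKP ε)) ∈ Gr := by
  have hε : ((ε : ℤ) : ℂ) ≠ 0 := left_ne_zero_of_mul_eq_one (sign_mul_self ε)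
  have hn : ∀ n : ℕ, ((ε : ℤ) : ℂ) ^ n * (n.factorial : ℂ) ≠ 0 := fun n =>
    mul_ne_zero (pow_ne_zero _ hε) (Nat.cast_ne_zero.mpr (Nat.factorial_ne_zero n))
  -- The `n`-th derivative at `x = 0` starts with `(ε z) ^ n`; the factor `ε ^ n` makes it monic.
  let b : ℕ → Lau := fun n => (((ε : ℤ) : ℂ) ^ n * (n.factorial : ℂ)) •
    PowerSeries.coeff n (atTimeZero (w * expKP ε))
  refine ⟨b, fun n => isMonic_iff.mpr ?_, le_antisymm ?_ ?_⟩
  · have h : w * expKP ε = (w - 1) * expKP ε + expKP ε := by ring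
    have h1 : (((ε : ℤ) : ℂ) ^ n * (n.factorial : ℂ)) •
        ((((ε : ℤ) : ℂ) ^ n * (n.factorial : ℂ)⁻¹) • zpow n) = zpow n := by
      have h2 : (((ε : ℤ) : ℂ) ^ n * (n.factorial : ℂ)) * (((ε : ℤ) : ℂ) ^ n * (n.factorial : ℂ)⁻¹)
          = 1 := by
        rw [mul_mul_mul_comm, ← mul_pow, sign_mul_self, one_pow, one_mul,
          mul_inv_cancel₀ (Nat.cast_ne_zero.mpr (Nat.factorial_ne_zero n))]
      simp only [← HahnSeries.C_mul_eq_smul]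
      rw [← mul_assoc, ← map_mul, h2, map_one, one_mul]
    have h3 : b n - zpow n = (((ε : ℤ) : ℂ) ^ n * (n.factorial : ℂ)) •
        MvPowerSeries.coeff (Finsupp.single 0 n) ((w - 1) * expKP ε) := by
      simp only [b]
      rw [atTimeZero_coeff, h, map_add, expKP_coeff_single]
      simp only [← HahnSeries.C_mul_eq_smul] at h1 ⊢
      linear_combination h1
    rw [h3]
    refine VB.smul _ ?_
    rw [MvPowerSeries.coeff_mul, Finsupp.antidiagonal_single, Finset.sum_map]
    refine VB.sum fun q hq => ?_
    rw [Finset.HasAntidiagonal.mem_antidiagonal] at hq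
    have h4 := (hw (Finsupp.single 0 q.1)).mul ((vb_zpow q.2).smul
      (((ε : ℤ) : ℂ) ^ q.2 * (q.2.factorial : ℂ)⁻¹))
    rw [← expKP_coeff_single] at h4
    exact h4.mono (by omega)
  · rw [planeOf_le_iff]
    exact fun n => (Submodule.smul_mem_iff _ (hn n)).mp (Submodule.subset_span ⟨n, rfl⟩)
  · rw [Submodule.span_le]
    rintro _ ⟨n, rfl⟩
    exact Submodule.smul_mem _ _ ((planeOf_le_iff _ _).mp le_rfl n)

/-! ### The plane determines the solution -/

/-- The total degree in the times `t_1, t_2, …`. -/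
def timeDegree : (ℕ →₀ ℕ) →+ ℕ := Finsupp.weight fun i => if i = 0 then 0 else 1

/-- The coefficients of the monomials of degree at most `d` in the times lie in `V`. -/
def CoeffsIn (V : Submodule ℂ Lau) (d : ℕ) (F : MvPowerSeries ℕ Lau) : Prop :=
  ∀ m, timeDegree m ≤ d → MvPowerSeries.coeff m F ∈ V

theorem pderiv_coeff_mem_iff (V : Submodule ℂ Lau) (F : MvPowerSeries ℕ Lau) (i : ℕ)
    (m : ℕ →₀ ℕ) : MvPowerSeries.coeff m (MvPowerSeries.pderiv Lau i F) ∈ V ↔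
      MvPowerSeries.coeff (m + Finsupp.single i 1) F ∈ V := by
  rw [MvPowerSeries.coeff_pderiv, ← Nat.cast_succ, mul_natCast_lau]
  exact Submodule.smul_mem_iff V (Nat.cast_ne_zero.mpr (Nat.succ_ne_zero _))

theorem CoeffsIn.pderiv {V : Submodule ℂ Lau} {d : ℕ} {F : MvPowerSeries ℕ Lau}
    (h : CoeffsIn V d F) (k : ℕ) : CoeffsIn V d ((MvPowerSeries.pderiv Lau 0)^[k] F) := by
  induction k with
  | zero => exact h
  | succ k ih =>
    intro m hm
    rw [Function.iterate_succ_apply', pderiv_coeff_mem_iff]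
    refine ih _ ?_
    rw [map_add]
    simpa [timeDegree, Finsupp.weight_single] using hm

theorem CoeffsIn.map_mul {V : Submodule ℂ Lau} {d : ℕ} {F : MvPowerSeries ℕ Lau}
    (h : CoeffsIn V d F) (f : Fun) :
    CoeffsIn V d (MvPowerSeries.map (HahnSeries.C : ℂ →+* Lau) f * F) := by
  intro m hm
  rw [MvPowerSeries.coeff_mul]
  refine Submodule.sum_mem _ fun q hq => ?_
  rw [MvPowerSeries.coeff_map, HahnSeries.C_mul_eq_smul]
  refine Submodule.smul_mem _ _ (h _ ?_)
  rw [← Finset.HasAntidiagonal.mem_antidiagonal.mp hq, map_add] at hm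
  omega

/-- `B` is a differential operator, a finite sum of `f D ^ k` with `k ≥ 0`. Neither `∂_x` nor
multiplication by a scalar series leads out of `V` or calls on higher time degrees. -/
theorem CoeffsIn.actExp_comp {V : Submodule ℂ Lau} {d : ℕ} {a : PsDO}
    (h : CoeffsIn V d (actExp 1 a)) (B : PsDO) (hB : ∀ n, 0 < n → B.coeff n = 0) :
    CoeffsIn V d (actExp 1 (comp B a)) := by
  suffices h' : ∀ (k : ℕ) (B : PsDO), (∀ n, 0 < n → B.coeff n = 0) → VB (1 - k : ℤ) B →
      CoeffsIn V d (actExp 1 (comp B a)) from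
    h' (1 - B.order).toNat B hB ((vb_order B).mono (by omega))
  intro k
  induction k with
  | zero =>
    intro B hB hB'
    have hB0 : B = HahnSeries.single (-(0 : ℕ) : ℤ) 0 := by
      ext1; funext n
      rcases le_or_gt n 0 with hn | hn
      · simp [hB' n (by push_cast; omega)]
      · simp [hB n hn]
    rw [hB0, actExp_single_comp]
    exact (h.pderiv 0).map_mul 0
  | succ k ih =>
    intro B hB hB'
    have hsplit : B = HahnSeries.single (-k : ℤ) (B.coeff (-k)) +
        (B - HahnSeries.single (-k : ℤ) (B.coeff (-k))) := by abel
    rw [hsplit, comp_add_left, actExp_add, actExp_single_comp]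
    have h1 := (h.pderiv k).map_mul (B.coeff (-k))
    have h2 := ih (B - HahnSeries.single (-k : ℤ) (B.coeff (-k))) (fun n hn => by
        rw [HahnSeries.coeff_sub, hB n hn, HahnSeries.coeff_single_of_ne (by omega), sub_zero])
      (fun n hn => by
        rcases eq_or_ne n (-k) with rfl | hn'
        · simp
        · rw [HahnSeries.coeff_sub, HahnSeries.coeff_single_of_ne hn',
            hB' n (by push_cast; omega), sub_zero])
    intro m hm
    rw [map_add]
    exact V.add_mem (h1 m hm) (h2 m hm)

theorem negPart_coeff (a : PsDO) (n : ℤ) :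
    (negPart a).coeff n = if 0 < n then a.coeff n else 0 := rfl

/-- `(S D ^ i S⁻¹)_+ S = S D ^ i - (S D ^ i S⁻¹)_- S`. -/
theorem posPart_comp {S R : PsDO} (h : comp R S = Dpow 0) (i : ℤ) :
    comp (comp (comp S (Dpow i)) R - negPart (comp (comp S (Dpow i)) R)) S =
      comp S (Dpow i) - comp (negPart (comp (comp S (Dpow i)) R)) S := by
  rw [eq_sub_iff_add_eq, ← comp_add_left, sub_add_cancel, comp_assoc, h, comp_Dpow_zero]

theorem CoeffsIn.posPart {V : Submodule ℂ Lau} {d : ℕ} {S : PsDO}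
    (h : CoeffsIn V d (actExp 1 S)) {R : PsDO} (hR : comp R S = Dpow 0) (i : ℤ) :
    CoeffsIn V d (actExp 1
      (comp S (Dpow i) - comp (negPart (comp (comp S (Dpow i)) R)) S)) := by
  rw [← posPart_comp hR]
  refine h.actExp_comp _ fun n hn => ?_
  rw [HahnSeries.coeff_sub, negPart_coeff, if_pos hn, sub_self]

theorem Solution.isMonicOp (K : Solution) : IsMonicOp K.S := ⟨K.coeff_zero, K.coeff_neg⟩

theorem Solution.isMonicOp_inv (K : Solution) : IsMonicOp K.Sinv := by
  obtain ⟨b, hb, hab, -⟩ := K.isMonicOp.exists_inv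
  rwa [left_inv_eq_right_inv K.inv_comp hab]

theorem Solution.wave_one (K : Solution) : K.wave 1 = actExp 1 K.S := if_pos rfl

theorem Solution.wave_neg_one (K : Solution) : K.wave (-1) = actExp (-1) (adj K.Sinv) :=
  if_neg (by decide)

theorem Solution.coeffsIn (K : Solution) (d : ℕ) : CoeffsIn (K.plane 1) d (K.wave 1) := by
  rw [K.wave_one]
  induction d with
  | zero =>
    intro m hm
    have hm' : m = Finsupp.single 0 (m 0) := by
      ext i
      rcases eq_or_ne i 0 with rfl | hi
      · simp
      · rw [Finsupp.single_eq_of_ne hi]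
        have := Finsupp.le_weight (fun i : ℕ => if i = 0 then 0 else 1) (s := i) (by simp [hi]) m
        exact Nat.le_zero.mp (this.trans hm)
    rw [hm', ← atTimeZero_coeff, ← K.wave_one]
    exact (planeOf_le_iff _ _).mp le_rfl (m 0)
  | succ d ih =>
    intro m hm
    by_cases hd : timeDegree m ≤ d
    · exact ih m hd
    -- Some `t_i` divides the monomial, so up to a nonzero factor its coefficient is one of `∂_{t_i}
    -- Ψ = (L ^ i)_+ Ψ`, at a smaller time degree.
    obtain ⟨i, hi, hmi⟩ : ∃ i, i ≠ 0 ∧ m i ≠ 0 := by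
      by_contra! hcon
      apply hd
      have : timeDegree m = 0 := by
        rw [timeDegree, Finsupp.weight_apply]
        refine Finset.sum_eq_zero fun i _ => ?_
        rcases eq_or_ne i 0 with rfl | hi
        · simp
        · simp [hcon i hi]
      omega
    have hle : Finsupp.single i 1 ≤ m := by
      rw [Finsupp.single_le_iff]
      omega
    obtain ⟨m', rfl⟩ : ∃ m', m = m' + Finsupp.single i 1 :=
      ⟨m - Finsupp.single i 1, (tsub_add_cancel_of_le hle).symm⟩
    rw [← pderiv_coeff_mem_iff, pderiv_actExp, if_neg hi, K.evol i (by omega), neg_add_eq_sub]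
    refine ih.posPart K.inv_comp i m' ?_
    rw [map_add] at hm
    simp only [timeDegree, Finsupp.weight_single, if_neg hi] at hm ⊢
    simp at hm
    exact hm

theorem Solution.wave_coeff_mem (K : Solution) (m : ℕ →₀ ℕ) :
    MvPowerSeries.coeff m (K.wave 1) ∈ K.plane 1 := K.coeffsIn _ m le_rfl

theorem Solution.eq_of_plane_eq {K K' : Solution} (h : K.plane 1 = K'.plane 1) : K = K' := by
  have hV : K.plane 1 ∈ Gr := by
    have := planeOf_mem_gr 1 (K.isMonicOp.symbol 1)
    rwa [← actExp, ← K.wave_one] at this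
  have h1 : symbol 1 K.S - symbol 1 K'.S = 0 := by
    refine eq_zero_of_mul_mem_gr hV (expKP_coeff_zero 1) (fun m => ?_) fun m => ?_
    · rw [← sub_sub_sub_cancel_right _ _ 1, map_sub]
      exact (K.isMonicOp.symbol 1 m).sub (K'.isMonicOp.symbol 1 m)
    · rw [sub_mul, ← actExp, ← actExp, ← K.wave_one, ← K'.wave_one, map_sub]
      exact Submodule.sub_mem _ (K.wave_coeff_mem m) (h ▸ K'.wave_coeff_mem m)
  have h2 : K.S = K'.S := symbol_one_injective (sub_eq_zero.mp h1)
  exact Solution.ext h2 (left_inv_eq_right_inv K.inv_comp (h2 ▸ K'.comp_inv))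

/-- A series in `x, t` over Laurent series in `1/z` is re-read as a series in `D⁻¹` over functions;
this needs a bound on the order uniform in `m`, which `hw` supplies. -/
theorem exists_symbol_eq {w : MvPowerSeries ℕ Lau}
    (hw : ∀ m, VB 1 (MvPowerSeries.coeff m (w - 1))) : ∃ S, IsMonicOp S ∧ symbol 1 S = w := by
  have h : ∀ m (n : ℤ), n < 1 → (MvPowerSeries.coeff m w).coeff n =
      (MvPowerSeries.coeff m (1 : MvPowerSeries ℕ Lau)).coeff n := fun m n hn => by
    have := hw m n hn
    rwa [map_sub, HahnSeries.coeff_sub, sub_eq_zero] at this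
  have h0 : ∀ n : ℤ, n < 0 → (fun m => (MvPowerSeries.coeff m w).coeff n : Fun) = 0 := by
    intro n hn
    funext m
    change (MvPowerSeries.coeff m w).coeff n = 0
    rw [h m n (by omega), MvPowerSeries.coeff_one]
    split_ifs
    · rw [HahnSeries.coeff_one, if_neg hn.ne]
    · simp
  refine ⟨HahnSeries.ofSuppBddBelow (fun n => (fun m => (MvPowerSeries.coeff m w).coeff n : Fun))
    (bddBelow_of_lt 0 h0), ⟨?_, h0⟩, ?_⟩
  · ext m
    refine (h m 0 one_pos).trans ?_
    rw [MvPowerSeries.coeff_one, MvPowerSeries.coeff_one]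
    split_ifs <;> simp
  · ext m n
    rw [symbol_one_coeff]
    rfl

/-- Sato's theorem for the big cell: every plane comes from exactly one solution. -/
theorem existsUnique_solution {V : Submodule ℂ Lau} (hV : V ∈ Gr) :
    ∃! K : Solution, K.plane 1 = V := by
  obtain ⟨w, hw, hwV⟩ := exists_mul_mem_gr hV (expKP_coeff_zero 1)
  obtain ⟨S, hS, rfl⟩ := exists_symbol_eq hw
  obtain ⟨R, -, hSR, hRS⟩ := hS.exists_inv
  have hC : ∀ d, CoeffsIn V d (actExp 1 S) := fun d m _ => hwV m
  have evol : ∀ i : ℕ, 1 ≤ i →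
      delCoeff i S = - comp (negPart (comp (comp S (Dpow (i : ℤ))) R)) S := by
    intro i hi
    set N := comp (negPart (comp (comp S (Dpow (i : ℤ))) R)) S with hN
    rw [← add_eq_zero_iff_eq_neg]
    apply symbol_one_injective
    have h0 : symbol 1 (0 : PsDO) = 0 := by
      ext m n
      rw [symbol_one_coeff]
      simp
    rw [h0]
    refine eq_zero_of_mul_mem_gr hV (expKP_coeff_zero 1) (fun m => VB.symbol (VB.add ?_ ?_) 1 m)
      fun m => ?_
    · intro n hn
      change del i (S.coeff n) = 0
      rcases eq_or_ne n 0 with rfl | hn'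
      · simp [hS.1, del]
      · rw [hS.2 n (by omega), map_zero]
    · have h1 : VB 1 (negPart (comp (comp S (Dpow (i : ℤ))) R)) := fun n hn => by
        rw [negPart_coeff, if_neg (by omega)]
      exact h1.comp hS.2
    -- `(∂_i S + N) e^{…} = ∂_{t_i} Ψ - (L ^ i)_+ Ψ`, and both terms on the right have coefficients
    -- in `V`.
    · have h1 := pderiv_actExp i S
      rw [if_neg (by omega), show delCoeff i S + comp S (Dpow i) =
        (delCoeff i S + N) + (comp S (Dpow i) - N) by abel, actExp_add, ← sub_eq_iff_eq_add] at h1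
      rw [← actExp, ← h1, map_sub]
      exact V.sub_mem ((pderiv_coeff_mem_iff V _ i m).mpr (hwV _))
        ((hC _).posPart hRS i m le_rfl)
  let K : Solution := ⟨S, R, hS.1, hS.2, hSR, hRS, evol⟩
  have hK : K.plane 1 = V := by
    have h1 : K.plane 1 = planeOf (atTimeZero (symbol 1 S * expKP 1)) := by
      rw [Solution.plane, Solution.waveX, K.wave_one]
      rfl
    rw [h1]
    refine eq_of_le_of_mem_gr (planeOf_mem_gr 1 hw) hV ((planeOf_le_iff _ _).mpr fun n => ?_)
    rw [atTimeZero_coeff]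
    exact hwV _
  exact ⟨K, hK, fun K' hK' => Solution.eq_of_plane_eq (hK'.trans hK.symm)⟩

/-! ### The bilinear identity and the adjoint plane -/

theorem VB.adj {B : ℤ} {b : PsDO} (hb : VB B b) : VB B (adj b) := fun n hn => by
  refine (finsum_congr fun k => ?_).trans finsum_zero
  rw [hb _ (by omega)]
  simp

/-- The residue of `(a e^{xz}) (b^* e^{-xz})` in `z` is the residue of `a b` in `D`. -/
theorem residue_symbol_mul (a b : PsDO) (m : ℕ →₀ ℕ) :
    (MvPowerSeries.coeff m (symbol 1 a * symbol (-1) (adj b))).coeff 1 =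
      MvPowerSeries.coeff m ((comp a b).coeff 1) := by
  rw [comp_coeff_one (vb_order a) (vb_order b), map_sum, MvPowerSeries.coeff_mul,
    HahnSeries.coeff_sum]
  simp_rw [MvPowerSeries.coeff_mul]
  rw [Finset.sum_comm]
  refine Finset.sum_congr rfl fun q _ => ?_
  rw [coeff_mul_eq_sum ((vb_order a).symbol 1 q.1) ((vb_order b).adj.symbol (-1) q.2) 1
    (Finset.Icc a.order (1 - b.order)) (fun i h1 h2 => Finset.mem_Icc.mpr (by omega))]
  refine Finset.sum_congr rfl fun i _ => ?_
  rw [symbol_one_coeff, symbol_coeff, map_zsmul, zsmul_eq_mul]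
  rfl

theorem Solution.residue_wave (K : Solution) (i j : ℕ) (m : ℕ →₀ ℕ) :
    (MvPowerSeries.coeff m ((MvPowerSeries.pderiv Lau 0)^[i] (K.wave 1) *
      (MvPowerSeries.pderiv Lau 0)^[j] (K.wave (-1)))).coeff 1 = 0 := by
  induction j generalizing i m with
  | zero =>
    have h : ∀ x y : MvPowerSeries ℕ Lau, x * expKP 1 * (y * expKP (-1)) = x * y := fun x y => by
      rw [mul_mul_mul_comm, expKP_mul_expKP_neg, mul_one]
    -- The exponentials cancel, and `D ^ i S S⁻¹ = D ^ i` with `i ≥ 0` has no term in `D⁻¹`.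
    rw [Function.iterate_zero_apply, K.wave_one, K.wave_neg_one, ← actExp_Dpow_comp, actExp,
      actExp, h, residue_symbol_mul, comp_assoc, K.comp_inv, comp_Dpow_zero, Dpow,
      HahnSeries.coeff_single_of_ne (by omega), map_zero]
  | succ j ih =>
    -- By the Leibniz rule a derivative on `Ψ^-` is traded for one on `Ψ^+` and an `x`-derivative of
    -- a residue already known to vanish.
    have h := congrArg (fun F => (MvPowerSeries.coeff m F).coeff 1)
      ((MvPowerSeries.pderiv Lau 0).leibniz ((MvPowerSeries.pderiv Lau 0)^[i] (K.wave 1))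
        ((MvPowerSeries.pderiv Lau 0)^[j] (K.wave (-1))))
    simp only [smul_eq_mul, map_add, HahnSeries.coeff_add] at h
    rw [MvPowerSeries.coeff_pderiv, ← Nat.cast_succ, mul_natCast_lau, HahnSeries.coeff_smul, ih,
      smul_zero, mul_comm ((MvPowerSeries.pderiv Lau 0)^[j] (K.wave (-1))),
      ← Function.iterate_succ_apply' (MvPowerSeries.pderiv Lau 0) i, ih, add_zero,
      ← Function.iterate_succ_apply' (MvPowerSeries.pderiv Lau 0) j] at h
    exact h.symm

theorem constantCoeff_dX_iterate_atTimeZero (F : MvPowerSeries ℕ Lau) (i : ℕ) :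
    PowerSeries.constantCoeff (dX^[i] (atTimeZero F)) =
      MvPowerSeries.constantCoeff ((MvPowerSeries.pderiv Lau 0)^[i] F) := by
  have h : ∀ F, dX (atTimeZero F) = atTimeZero (MvPowerSeries.pderiv Lau 0 F) := by
    intro F
    ext1 n
    rw [dX, PowerSeries.coeff_derivative, atTimeZero_coeff, atTimeZero_coeff,
      MvPowerSeries.coeff_pderiv, ← Finsupp.single_add, Finsupp.single_eq_same]
  have h' : dX^[i] (atTimeZero F) = atTimeZero ((MvPowerSeries.pderiv Lau 0)^[i] F) := by
    induction i with
    | zero => rfl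
    | succ i ih => rw [Function.iterate_succ_apply', ih, h, Function.iterate_succ_apply']
  rw [h', ← PowerSeries.coeff_zero_eq_constantCoeff_apply, atTimeZero_coeff, Finsupp.single_zero,
    MvPowerSeries.coeff_zero_eq_constantCoeff_apply]

theorem Solution.exists_wave (K : Solution) (ε : ℤˣ) :
    ∃ a, IsMonicOp a ∧ K.wave ε = symbol ε a * expKP ε := by
  rcases Int.units_eq_one_or ε with rfl | rfl
  · exact ⟨K.S, K.isMonicOp, K.wave_one⟩
  · exact ⟨_, K.isMonicOp_inv.adj, K.wave_neg_one⟩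

theorem Solution.plane_eq (K : Solution) (ε : ℤˣ) : K.plane ε = planeOf (K.waveX ε) := rfl

theorem Solution.plane_mem_gr (K : Solution) (ε : ℤˣ) : K.plane ε ∈ Gr := by
  obtain ⟨a, ha, h⟩ := K.exists_wave ε
  rw [K.plane_eq, Solution.waveX, h]
  exact planeOf_mem_gr ε (ha.symbol ε)

/-- The adjoint plane is the orthogonal complement for the residue pairing. -/
theorem Solution.plane_neg_one (K : Solution) : K.plane (-1) = perp (K.plane 1) := by
  refine eq_perp_of_le (K.plane_mem_gr 1) (K.plane_mem_gr (-1)) (Submodule.span_le.mpr ?_)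
  rintro _ ⟨j, rfl⟩ f hf
  refine Submodule.span_induction (p := fun f _ => (f * PowerSeries.constantCoeff
    (dX^[j] (K.waveX (-1)))).coeff 1 = 0) ?_ ?_ ?_ ?_ hf
  · rintro _ ⟨i, rfl⟩
    simp only [Solution.waveX]
    rw [constantCoeff_dX_iterate_atTimeZero, constantCoeff_dX_iterate_atTimeZero, ← map_mul,
      ← MvPowerSeries.coeff_zero_eq_constantCoeff_apply]
    exact K.residue_wave i j 0
  · simp
  · intro x y _ _ hx hy
    rw [add_mul, HahnSeries.coeff_add, hx, hy, add_zero]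
  · intro c x _ hx
    rw [mul_comm, mul_smul_lau, HahnSeries.coeff_smul, mul_comm, hx, smul_zero]

/-! ### The differential equation in `x` -/

theorem coeff_actZ (T : Module.End ℂ Lau) (F : PowerSeries Lau) (n : ℕ) :
    PowerSeries.coeff n (actZ T F) = T (PowerSeries.coeff n F) := PowerSeries.coeff_mk _ _

theorem coeff_dX (F : PowerSeries Lau) (n : ℕ) :
    PowerSeries.coeff n (dX F) = ((n + 1 : ℕ) : ℂ) • PowerSeries.coeff (n + 1) F := by
  rw [dX, PowerSeries.coeff_derivative, ← Nat.cast_succ, mul_natCast_lau]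

theorem actZ_euler_mul (F G : PowerSeries Lau) :
    actZ euler (F * G) = actZ euler F * G + F * actZ euler G := by
  ext1 n
  rw [coeff_actZ, map_add, PowerSeries.coeff_mul, PowerSeries.coeff_mul, PowerSeries.coeff_mul,
    map_sum, ← Finset.sum_add_distrib]
  exact Finset.sum_congr rfl fun q _ => by rw [euler_mul, coeff_actZ, coeff_actZ]

theorem actZ_opA (p : ℕ) (ε : ℤˣ) (F : PowerSeries Lau) : actZ (opA p ε) F =
    PowerSeries.C (zpow 1) * F +
      PowerSeries.C (HahnSeries.C (((ε : ℤ) : ℂ) / p) * zpow (-p)) *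
        (actZ euler F - PowerSeries.C (HahnSeries.C (((p : ℂ) - 1) / 2)) * F) := by
  ext1 n
  rw [coeff_actZ, opA_apply, map_add, PowerSeries.coeff_C_mul, PowerSeries.coeff_C_mul, map_sub,
    PowerSeries.coeff_C_mul, coeff_actZ, mul_assoc]
  simp only [HahnSeries.C_mul_eq_smul]

theorem dX_atTimeZero_expKP (ε : ℤˣ) : dX (atTimeZero (expKP ε)) =
    PowerSeries.C (HahnSeries.C ((ε : ℤ) : ℂ) * zpow 1) * atTimeZero (expKP ε) := by
  ext1 n
  have h := congrArg (MvPowerSeries.coeff (Finsupp.single 0 n)) (pderiv_expKP ε 0)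
  rw [MvPowerSeries.coeff_pderiv, MvPowerSeries.coeff_C_mul, ← Finsupp.single_add,
    Finsupp.single_eq_same, if_pos rfl, ← HahnSeries.C_mul_eq_smul] at h
  rw [dX, PowerSeries.coeff_derivative, PowerSeries.coeff_C_mul, atTimeZero_coeff,
    atTimeZero_coeff, h]

/-- At `t = 0` the exponential depends on `x z` only, so `z ∂_z` acts on it as `x ∂_x`. -/
theorem actZ_euler_expKP (ε : ℤˣ) : actZ euler (atTimeZero (expKP ε)) =
    PowerSeries.X * (PowerSeries.C (HahnSeries.C ((ε : ℤ) : ℂ) * zpow 1) *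
      atTimeZero (expKP ε)) := by
  rw [← dX_atTimeZero_expKP]
  ext1 n
  have h : euler (PowerSeries.coeff n (atTimeZero (expKP ε))) =
      (n : ℂ) • PowerSeries.coeff n (atTimeZero (expKP ε)) := by
    rw [atTimeZero_coeff, expKP_coeff_single, map_smul, euler_zpow, Int.cast_natCast]
    simp only [← HahnSeries.C_mul_eq_smul]
    ring
  rw [coeff_actZ, h]
  cases n with
  | zero => rw [PowerSeries.coeff_zero_X_mul, ← HahnSeries.C_mul_eq_smul, Nat.cast_zero, map_zero,
      zero_mul]
  | succ n => rw [PowerSeries.coeff_succ_X_mul, coeff_dX]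

theorem eq_zero_of_powerSeries_mul_mem_gr {V : Submodule ℂ Lau} (hV : V ∈ Gr)
    {v E : PowerSeries Lau} (hE : PowerSeries.coeff 0 E = 1)
    (hv : ∀ n, VB 1 (PowerSeries.coeff n v)) (h : ∀ n, PowerSeries.coeff n (v * E) ∈ V) :
    v = 0 := by
  have hm : ∀ (F : PowerSeries Lau) (m : Unit →₀ ℕ),
      MvPowerSeries.coeff m F = PowerSeries.coeff (m ()) F := fun F m => by
    rw [PowerSeries.coeff_def rfl]
  refine eq_zero_of_mul_mem_gr (σ := Unit) hV (E := E) ?_ (fun m => ?_) fun m => ?_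
  · rw [hm]
    exact hE
  · rw [hm]
    exact hv _
  · have := h (m ())
    rwa [← hm] at this

theorem vb_C (c : ℂ) : VB 0 (HahnSeries.C c : Lau) := vb_single 0 c

theorem actZ_opA_eq_dX (p : ℕ) (hp : 2 ≤ p) (ε : ℤˣ) {V : Submodule ℂ Lau} (hV : V ∈ Gr)
    (hA : Stable (opA p ε) V) {a : PsDO} (ha : IsMonicOp a)
    (h : ∀ n, PowerSeries.coeff n (atTimeZero (symbol ε a * expKP ε)) ∈ V) :
    actZ (opA p ε) (atTimeZero (symbol ε a * expKP ε)) =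
      (ε : ℤ) • dX (atTimeZero (symbol ε a * expKP ε)) := by
  have hs : (PowerSeries.C (HahnSeries.C ((ε : ℤ) : ℂ)) : PowerSeries Lau) *
      PowerSeries.C (HahnSeries.C ((ε : ℤ) : ℂ)) = 1 := by
    rw [← map_mul, ← map_mul, sign_mul_self, map_one, map_one]
  have hsmul : ∀ F : PowerSeries Lau, (ε : ℤ) • F =
      PowerSeries.C (HahnSeries.C ((ε : ℤ) : ℂ)) * F := fun F => by
    rw [zsmul_eq_mul, map_intCast, map_intCast]
  have hw0 : ∀ n, VB 0 (PowerSeries.coeff n (atTimeZero (symbol ε a))) := fun n => by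
    rw [atTimeZero_coeff]
    exact ha.2.symbol ε _
  have hw1 : ∀ n, VB 1 (PowerSeries.coeff (n + 1) (atTimeZero (symbol ε a))) := fun n => by
    have := ha.symbol ε (Finsupp.single 0 (n + 1))
    rwa [map_sub, MvPowerSeries.coeff_one, if_neg (by simp), sub_zero, ← atTimeZero_coeff] at this
  have hmul := atTimeZero_mul (symbol ε a) (expKP ε)
  set F := atTimeZero (symbol ε a * expKP ε)
  set w := atTimeZero (symbol ε a)
  set e := atTimeZero (expKP ε) with he
  set u : PowerSeries Lau := PowerSeries.C (HahnSeries.C (((ε : ℤ) : ℂ) / p) * zpow (-p)) *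
      (actZ euler w + PowerSeries.X * (PowerSeries.C (HahnSeries.C ((ε : ℤ) : ℂ) * zpow 1) * w) -
        PowerSeries.C (HahnSeries.C (((p : ℂ) - 1) / 2)) * w) -
      PowerSeries.C (HahnSeries.C ((ε : ℤ) : ℂ)) * dX w with hu
  -- The term `z F` of `A F` cancels against `ε · ε z F`, from `∂_x` acting on the exponential.
  have key : actZ (opA p ε) F - (ε : ℤ) • dX F = u * e := by
    have hd : dX (w * e) = w * dX e + e * dX w := by
      rw [dX, Derivation.leibniz, smul_eq_mul, smul_eq_mul]
      rfl
    rw [hmul, actZ_opA, actZ_euler_mul, actZ_euler_expKP, hsmul, hd, dX_atTimeZero_expKP, ← he, hu,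
      map_mul PowerSeries.C (HahnSeries.C ((ε : ℤ) : ℂ)) (zpow 1)]
    linear_combination (-(PowerSeries.C (zpow 1) * w * e)) * hs
  have hu0 : u = 0 := by
    refine eq_zero_of_powerSeries_mul_mem_gr hV (E := e) ?_ (fun n => ?_) fun n => ?_
    · rw [he, atTimeZero_coeff, Finsupp.single_zero, expKP_coeff_zero]
    · have hk : VB p (HahnSeries.C (((ε : ℤ) : ℂ) / p) * zpow (-p)) := by
        simpa using (vb_C (((ε : ℤ) : ℂ) / p)).mul (vb_zpow (-p))
      -- The bound is `-1` because of the term `ε x z w`, from the Euler operator acting on the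
      -- exponential. After the factor `z ^ (-p)` the order is at least `p - 1`, and this is where
      -- `p ≥ 2` enters.
      have h1 : VB (-1) (PowerSeries.coeff n (actZ euler w + PowerSeries.X *
          (PowerSeries.C (HahnSeries.C ((ε : ℤ) : ℂ) * zpow 1) * w) -
          PowerSeries.C (HahnSeries.C (((p : ℂ) - 1) / 2)) * w)) := by
        rw [map_sub, map_add, coeff_actZ, PowerSeries.coeff_C_mul]
        refine VB.sub (VB.add ?_ ?_) ?_
        · intro k hk
          rw [euler_coeff, hw0 n k (by omega), mul_zero]
        · cases n with
          | zero =>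
            rw [PowerSeries.coeff_zero_X_mul]
            exact vb_zero _
          | succ n =>
            rw [PowerSeries.coeff_succ_X_mul, PowerSeries.coeff_C_mul]
            exact (((vb_C _).mul (vb_zpow 1)).mul (hw0 n)).mono (by omega)
        · exact ((vb_C _).mul (hw0 n)).mono (by omega)
      rw [hu, map_sub, PowerSeries.coeff_C_mul, PowerSeries.coeff_C_mul, coeff_dX]
      exact ((hk.mul h1).mono (by omega)).sub (((vb_C _).mul ((hw1 n).smul _)).mono (by omega))
    · rw [← key, map_sub, coeff_actZ, hsmul, PowerSeries.coeff_C_mul, HahnSeries.C_mul_eq_smul,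
        coeff_dX]
      exact V.sub_mem (hA ⟨_, h n, rfl⟩) (V.smul_mem _ (V.smul_mem _ (h (n + 1))))
  rwa [hu0, zero_mul, sub_eq_zero] at key

/-- Uniqueness for the initial value problem `T F = ± ∂_x F`. -/
theorem eq_of_actZ_eq_dX {T : Module.End ℂ Lau} {ε : ℤˣ} {F G : PowerSeries Lau}
    (h0 : PowerSeries.constantCoeff F = PowerSeries.constantCoeff G)
    (hF : actZ T F = (ε : ℤ) • dX F) (hG : actZ T G = (ε : ℤ) • dX G) : F = G := by
  ext1 n
  induction n with
  | zero => rwa [PowerSeries.coeff_zero_eq_constantCoeff_apply,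
      PowerSeries.coeff_zero_eq_constantCoeff_apply]
  | succ n ih =>
    have hF' := congrArg (PowerSeries.coeff n) hF
    have hG' := congrArg (PowerSeries.coeff n) hG
    rw [coeff_actZ, map_zsmul, coeff_dX] at hF' hG'
    rw [ih, hG'] at hF'
    have hc : ((n + 1 : ℕ) : ℂ) ≠ 0 := Nat.cast_ne_zero.mpr (Nat.succ_ne_zero n)
    have h1 : ((n + 1 : ℕ) : ℂ) • PowerSeries.coeff (n + 1) G =
        ((n + 1 : ℕ) : ℂ) • PowerSeries.coeff (n + 1) F := by
      rcases Int.units_eq_one_or ε with rfl | rfl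
      · simpa only [Units.val_one, one_smul] using hF'
      · simpa only [Units.val_neg, Units.val_one, neg_smul, one_smul, neg_inj] using hF'
    exact ((smul_right_injective Lau hc) h1).symm

theorem isMonic_zero_waveX (K : Solution) (ε : ℤˣ) :
    IsMonic 0 (PowerSeries.constantCoeff (K.waveX ε)) := by
  obtain ⟨a, ha, h⟩ := K.exists_wave ε
  have h1 := ha.symbol ε 0
  rw [← PowerSeries.coeff_zero_eq_constantCoeff_apply, Solution.waveX, atTimeZero_coeff,
    Finsupp.single_zero, h, MvPowerSeries.coeff_zero_eq_constantCoeff_apply, map_mul,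
    ← MvPowerSeries.coeff_zero_eq_constantCoeff_apply,
    ← MvPowerSeries.coeff_zero_eq_constantCoeff_apply, expKP_coeff_zero, mul_one]
  rw [map_sub, MvPowerSeries.coeff_zero_one, ← zpow_zero] at h1
  exact isMonic_iff.mpr (by simpa using h1)

end KP

end

theorem theorem2p3 (p : ℕ) (hp : 1 ≤ p) :
    ∃ (W : ℤˣ → Submodule ℂ KP.Lau) (φ : ℤˣ → KP.Lau),
      -- the invariance conditions single out one point `W ε` of the Grassmannian
      (∀ (ε : ℤˣ) (V : Submodule ℂ KP.Lau),
        (V ∈ KP.Gr ∧ KP.Stable (KP.mulZ p) V ∧ KP.Stable (KP.opA p ε) V) ↔ V = W ε) ∧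
      -- `φ ε` is the unique solution `1 + O(1/z)` of `A ^ p φ = z ^ p φ`
      (∀ (ε : ℤˣ) (f : KP.Lau),
        (KP.IsMonic 0 f ∧ (KP.opA p ε ^ p) f = KP.zpow p * f) ↔ f = φ ε) ∧
      -- `W ε` is spanned by the `A ^ i φ`
      (∀ ε : ℤˣ, W ε = Submodule.span ℂ (Set.range fun i : ℕ => (KP.opA p ε ^ i) (φ ε))) ∧
      -- there is exactly one KP solution with plane `W 1`, and its adjoint plane is `W (-1)`
      (∃! K : KP.Solution, K.plane 1 = W 1) ∧
      (∀ K : KP.Solution, K.plane 1 = W 1 →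
        K.plane (-1) = W (-1) ∧
        -- its wave function and adjoint wave function at `t = 0` are the unique solutions of the
        -- two initial value problems
        (2 ≤ p → ∀ (ε : ℤˣ) (F : PowerSeries KP.Lau),
          (PowerSeries.constantCoeff F = φ ε ∧
            KP.actZ (KP.opA p ε) F = (ε : ℤ) • KP.dX F) ↔ F = K.waveX ε)) := by
  choose φ hφ hφ' using fun ε => KP.existsUnique_opA_pow p hp ε
  have hW : ∀ (ε : ℤˣ) (V : Submodule ℂ KP.Lau),
      (V ∈ KP.Gr ∧ KP.Stable (KP.mulZ p) V ∧ KP.Stable (KP.opA p ε) V) ↔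
        V = KP.opASpan p ε (φ ε) :=
    fun ε => KP.gr_stable_iff p hp ε (hφ ε).1 (hφ ε).2
  refine ⟨fun ε => KP.opASpan p ε (φ ε), φ, hW, fun ε f => ⟨hφ' ε f, ?_⟩, fun ε => rfl,
    KP.existsUnique_solution (KP.opASpan_mem_gr p 1 (hφ 1).1), fun K hK => ?_⟩
  · rintro rfl
    exact hφ ε
  have hK' : K.plane (-1) = KP.opASpan p (-1) (φ (-1)) := by
    obtain ⟨-, hz, hA⟩ := (hW 1 _).mpr hK
    refine (hW (-1) _).mp ⟨K.plane_mem_gr (-1), ?_, ?_⟩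
    · rw [K.plane_neg_one]
      exact KP.stable_perp (KP.mulZ_transpose p) hz
    · rw [K.plane_neg_one]
      exact KP.stable_perp (KP.opA_transpose p 1) hA
  refine ⟨hK', fun hp2 ε F => ?_⟩
  have hplane : K.plane ε = KP.opASpan p ε (φ ε) := by
    rcases Int.units_eq_one_or ε with rfl | rfl
    · exact hK
    · exact hK'
  have hmem : ∀ n, PowerSeries.coeff n (K.waveX ε) ∈ KP.opASpan p ε (φ ε) := by
    rw [← KP.planeOf_le_iff, ← K.plane_eq, hplane]
  obtain ⟨hG, -, hA⟩ := (hW ε _).mpr rfl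
  -- Both are elements `1 + O(1/z)` of the same plane, which has only one.
  have hconst : PowerSeries.constantCoeff (K.waveX ε) = φ ε :=
    KP.eq_of_isMonic_zero_mem_gr hG (by simpa using hmem 0) (Submodule.subset_span ⟨0, rfl⟩)
      (KP.isMonic_zero_waveX K ε) (hφ ε).1
  have hode : KP.actZ (KP.opA p ε) (K.waveX ε) = (ε : ℤ) • KP.dX (K.waveX ε) := by
    obtain ⟨a, ha, h⟩ := K.exists_wave ε
    rw [KP.Solution.waveX, h] at hmem ⊢
    exact KP.actZ_opA_eq_dX p hp2 ε hG hA ha hmem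
  constructor
  · rintro ⟨h0, h1⟩
    exact KP.eq_of_actZ_eq_dX (h0.trans hconst.symm) h1 hode
  · rintro rfl
    exact ⟨hconst, hode⟩
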